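/- Write $\mathbb{R}_+=(0,\infty)$. A weight is a positive locally integrable function on $\mathbb{R}_+$, and for a weight $w$ and $1\le p\le\infty$ put $$\|f\|_{L_p^w}=\Big(\int_0^\infty w(x)^p|f(x)|^p\,dx\Big)^{1/p}\quad(p<\infty),\qquad \|f\|_{L_\infty^w}=\operatorname*{ess\,sup}_{x>0}w(x)|f(x)| .$$ For $\alpha>\frac12$ let $$\mathbf{H}_\alpha(x)=\Big(\frac x2\Big)^{\alpha+1}\sum_{k=0}^\infty\frac{(-1)^k(x/2)^{2k}}{\Gamma(k+\frac32)\,\Gamma(k+\alpha+\frac32)},\qquad x>0,$$ be the Struve function, and let $$\mathscr{H}_\alpha f(y)=\lim_{N\to\infty}\int_0^N f(x)\,(xy)^{1/2}\,\mathbf{H}_\alpha(xy)\,dx,\qquad y>0,$$ be the Struve transform. It is considered for those (real- or complex-valued) measurable functions $f$ on $\mathbb{R}_+$ such that, for every $y>0$, the integrand is integrable on $(0,N)$ for every $N>0$ and the limit exists and is finite. **Theorem 5.1.** Let $\alpha>\frac12$, $1\le p\le q\le\infty$, $\frac1p+\frac1{p'}=1$, and let $u,v$ be weights. There is a constant $C>0$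 such that $$\|\mathscr{H}_\alpha f\|_{L_q^u}\le C\,\|f\|_{L_p^v}$$ for every such $f$ if and only if both conditions $$\sup_{t>0}\Big(\int_0^{1/t}x^{(\alpha+\frac32)q}u(x)^q\,dx\Big)^{1/q}\Big(\int_0^t x^{(\alpha+\frac32)p'}v(x)^{-p'}\,dx\Big)^{1/p'}<\infty,$$ $$\sup_{t>0}\Big(\int_{1/t}^\infty x^{(\alpha-\frac12)q}u(x)^q\,dx\Big)^{1/q}\Big(\int_t^\infty x^{(\alpha-\frac12)p'}v(x)^{-p'}\,dx\Big)^{1/p'}<\infty$$ hold, where for $q=\infty$ or $p'=\infty$ the corresponding factor is replaced by the essential supremum over the same interval (for instance $\operatorname*{ess\,sup}_{0<x<1/t}x^{\alpha+\frac32}u(x)$). Norms and integrals may take the value $+\infty$. -/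

import Mathlib

open MeasureTheory Set Filter Topology
open scoped ENNReal NNReal

noncomputable section

/-- The Struve function `𝐇_α(x) = (x/2)^(α+1) ∑ₖ (-1)ᵏ (x/2)^(2k) / (Γ(k+3/2) Γ(k+α+3/2))`,
used for `x > 0`, where the series converges absolutely. -/
def struveH (α x : ℝ) : ℝ :=
  (x / 2) ^ (α + 1) *
    ∑' k : ℕ, (-1 : ℝ) ^ k * (x / 2) ^ (2 * k) /
      (Real.Gamma ((k : ℝ) + 3 / 2) * Real.Gamma ((k : ℝ) + α + 3 / 2))

/-- The kernel `(x y)^(1/2) 𝐇_α(x y)` of the Struve transform. -/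
def struveKernel (α x y : ℝ) : ℝ :=
  (x * y) ^ (1 / 2 : ℝ) * struveH α (x * y)

/-- `ℋ_α f` exists pointwise as an improper integral: for every `y > 0` the function
`x ↦ f(x) (xy)^(1/2) 𝐇_α(xy)` is integrable on `(0, N]` for every `N > 0` and the limit of
`∫₀ᴺ f(x) (xy)^(1/2) 𝐇_α(xy) dx` as `N → ∞` exists and is finite. -/
def StruveTransformExists {𝕜 : Type*} [RCLike 𝕜] (α : ℝ) (f : ℝ → 𝕜) : Prop :=
  ∀ y : ℝ, 0 < y →
    (∀ N : ℝ, 0 < N → IntegrableOn (fun x => struveKernel α x y • f x) (Ioc 0 N)) ∧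
    ∃ l : 𝕜, Tendsto (fun N : ℝ => ∫ x in Ioc 0 N, struveKernel α x y • f x) atTop (𝓝 l)

/-- The Struve transform `ℋ_α f(y) = lim_{N → ∞} ∫₀ᴺ f(x) (xy)^(1/2) 𝐇_α(xy) dx`; meaningful for
`y > 0` when `StruveTransformExists α f`. -/
def struveTransform {𝕜 : Type*} [RCLike 𝕜] (α : ℝ) (f : ℝ → 𝕜) (y : ℝ) : 𝕜 :=
  limUnder atTop (fun N : ℝ => ∫ x in Ioc 0 N, struveKernel α x y • f x)

/-- A weight: a positive locally integrable function on `(0, ∞)`. -/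
structure IsWeight (w : ℝ → ℝ) : Prop where
  pos : ∀ x : ℝ, 0 < x → 0 < w x
  locallyIntegrable : LocallyIntegrableOn w (Ioi 0)

/-- The weighted Lebesgue norm `‖f‖_{L_p^w} = (∫₀^∞ w(x)^p |f(x)|^p dx)^(1/p)` for `p < ∞`, and
`ess sup_{x > 0} w(x) |f(x)|` for `p = ∞`, with values in `[0, ∞]`. -/
def weightedNorm {𝕜 : Type*} [RCLike 𝕜] (p : ℝ≥0∞) (w : ℝ → ℝ) (f : ℝ → 𝕜) : ℝ≥0∞ :=
  eLpNorm (fun x => w x • f x) p (volume.restrict (Ioi 0))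

end

/-! For `α > 1/2` the Struve kernel is positive and comparable to `(xy)^(α - 1/2) * min 1 ((xy)^2)`,
so nothing is lost by cancellation. Up to constants, on nonnegative functions, the transform is the
sum of two Hardy operators: `y^(α + 3/2) ∫_{x < 1/y} x^(α + 3/2) f` and `y^(α - 1/2) ∫_{x > 1/y}
x^(α - 1/2) f`. The two conditions are the Muckenhoupt conditions for these operators.

Kernel. Integrating Poisson's formula for the Struve function by parts represents it as a power of
`z` times an average of `1 - cos (z √s)` against a positive density (`struveH_eq`, proved here by
comparing power series). The upper bound is immediate; the lower bound needs only the part `1/4 ≤ s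
≤ 9/16` of the integral. Together they give `exists_struveKernel_bounds`.

Sufficiency. The modulus of the transform is at most the absolute integral, which splits at `x =
1/y`. Each half is controlled by `hardy_inequality`, proved by cutting the range of the inner
integral into dyadic levels and applying Hölder on each level.

Necessity. On `{x < t} × {y < 1/t}`, and likewise on `{x > t} × {y > 1/t}`, the kernel is at least
`c x^a y^a`. Testing on bounded nonnegative functions of compact support bounds the norm of `y^a u`
times `∫ x^a φ` by the norm of `v φ`; the extremizers of Hölder's inequality, truncated, turn this
into the product of norms (`mul_eLpNorm_le_of_forall_test`). -/

/-! ### Integral representation of the Struve function -/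

/-- The density `β (1 - s)^(β - 1)` on `(0, 1)`. -/
noncomputable def struveDensity (β s : ℝ) : ℝ := β * (1 - s) ^ (β - 1)

/-- The integral `∫₀¹ (1 - cos (z √s)) β (1 - s)^(β - 1) ds`, which is the Struve function
`𝐇_(β + 1/2)` up to a power of `z` and a constant. -/
noncomputable def struveProfile (β z : ℝ) : ℝ :=
  ∫ s in (0 : ℝ)..1, (1 - Real.cos (z * √s)) * struveDensity β s

lemma struveDensity_nonneg {β s : ℝ} (hβ : 0 < β) (hs : s ≤ 1) : 0 ≤ struveDensity β s :=
  mul_nonneg hβ.le (Real.rpow_nonneg (by linarith) _)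

lemma intervalIntegrable_struveDensity {β : ℝ} (hβ : 0 < β) :
    IntervalIntegrable (struveDensity β) volume 0 1 := by
  have h : IntervalIntegrable (fun x : ℝ => x ^ (β - 1)) volume 0 1 :=
    intervalIntegral.intervalIntegrable_rpow' (by linarith)
  have h2 := (h.comp_sub_left 1).symm
  simp only [sub_zero, sub_self] at h2
  exact h2.const_mul β

lemma measurable_struveDensity (β : ℝ) : Measurable (struveDensity β) := by
  unfold struveDensity; fun_prop

lemma integral_pow_mul_struveDensity {β : ℝ} (hβ : 0 < β) (k : ℕ) :
    ∫ s in (0 : ℝ)..1, s ^ k * struveDensity β s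
      = k.factorial * Real.Gamma (β + 1) / Real.Gamma (k + 1 + β) := by
  have h1 : ∫ s in (0 : ℝ)..1, s ^ k * (1 - s) ^ (β - 1)
      = k.factorial * Real.Gamma β / Real.Gamma (k + 1 + β) := by
    have := Complex.betaIntegral_eq_Gamma_mul_div ((k + 1 : ℝ) : ℂ) (β : ℂ)
      (by rw [Complex.ofReal_re]; positivity) (by simpa using hβ)
    rw [← Complex.ofReal_inj, Complex.ofReal_div, Complex.ofReal_mul, ← Real.Gamma_nat_eq_factorial,
      ← Complex.Gamma_ofReal, ← Complex.Gamma_ofReal, ← Complex.Gamma_ofReal]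
    rw [← Complex.ofReal_add] at this
    rw [← this, Complex.betaIntegral, ← intervalIntegral.integral_ofReal]
    refine intervalIntegral.integral_congr fun s hs => ?_
    rw [uIcc_of_le zero_le_one] at hs
    have : (1 - (s : ℂ)) = ((1 - s : ℝ) : ℂ) := by push_cast; rfl
    simp only [this]
    rw [← Complex.ofReal_one, ← Complex.ofReal_sub, ← Complex.ofReal_sub,
      ← Complex.ofReal_cpow hs.1, ← Complex.ofReal_cpow (by linarith [hs.2])]
    simp
  have h2 : ∀ s : ℝ, s ^ k * struveDensity β s = β * (s ^ k * (1 - s) ^ (β - 1)) := fun s => by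
    unfold struveDensity; ring
  simp_rw [h2]
  rw [intervalIntegral.integral_const_mul, h1, Real.Gamma_add_one hβ.ne']
  ring

lemma hasSum_one_sub_cos (w : ℝ) :
    HasSum (fun k : ℕ => (-1 : ℝ) ^ k * w ^ (2 * k + 2) / (2 * k + 2).factorial)
      (1 - Real.cos w) := by
  have h := (hasSum_nat_add_iff' 1).mpr (Real.hasSum_cos w)
  have h2 := h.neg
  simp only [Finset.range_one, Finset.sum_singleton] at h2
  have e : -(Real.cos w - (-1 : ℝ) ^ 0 * w ^ (2 * 0) / ↑(2 * 0).factorial) = 1 - Real.cos w := by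
    norm_num
  rw [e] at h2
  refine h2.congr_fun fun k => ?_
  rw [show 2 * (k + 1) = 2 * k + 2 by ring]; ring

/-- The series of `1 - cos` is integrated term by term, dominated by the series of `cosh z`; the
moments of the density are Beta integrals. -/
lemma hasSum_struveProfile {β : ℝ} (hβ : 0 < β) (z : ℝ) :
    HasSum (fun k : ℕ => (-1 : ℝ) ^ k * z ^ (2 * k + 2) / (2 * k + 2).factorial *
      ((k + 1).factorial * Real.Gamma (β + 1) / Real.Gamma ((k + 1 : ℕ) + 1 + β)))
      (struveProfile β z) := by
  have hb := fun n : ℕ => integral_pow_mul_struveDensity hβ (n + 1)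
  have hsum : Summable fun n : ℕ => |z| ^ (2 * n + 2) / (2 * n + 2).factorial := by
    have := (Real.hasSum_cosh z).summable
    have := (summable_nat_add_iff 1).mpr this
    refine this.congr fun n => ?_
    rw [show 2 * (n + 1) = 2 * n + 2 by ring, ← Even.pow_abs (⟨n + 1, by ring⟩ : Even (2 * n + 2)) z]
  have := intervalIntegral.hasSum_integral_of_dominated_convergence (μ := volume) (a := 0) (b := 1)
    (F := fun (k : ℕ) s => (-1 : ℝ) ^ k * (z * √s) ^ (2 * k + 2) / (2 * k + 2).factorial
      * struveDensity β s)
    (f := fun s => (1 - Real.cos (z * √s)) * struveDensity β s)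
    (fun n s => |z| ^ (2 * n + 2) / (2 * n + 2).factorial * struveDensity β s)
    (fun n => by
      have := measurable_struveDensity β
      exact Measurable.aestronglyMeasurable (by fun_prop))
    (fun n => Eventually.of_forall fun s hs => by
      rw [uIoc_of_le zero_le_one] at hs
      rw [norm_mul, norm_div, norm_mul, norm_pow, norm_neg, norm_one, one_pow, one_mul,
        Real.norm_of_nonneg (struveDensity_nonneg hβ hs.2), Real.norm_natCast, norm_pow]
      have : ‖z * √s‖ ≤ |z| := by
        rw [norm_mul, Real.norm_of_nonneg (Real.sqrt_nonneg s)]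
        exact mul_le_of_le_one_right (norm_nonneg z) (Real.sqrt_le_one.mpr hs.2)
      have := struveDensity_nonneg hβ hs.2
      gcongr)
    (Eventually.of_forall fun s _ => hsum.mul_right _)
    (by
      simp_rw [tsum_mul_right]
      exact (intervalIntegrable_struveDensity hβ).const_mul _)
    (Eventually.of_forall fun s _ => (hasSum_one_sub_cos _).mul_right _)
  refine this.congr_fun fun k => ?_
  rw [← hb k, ← intervalIntegral.integral_const_mul]
  refine intervalIntegral.integral_congr fun s hs => ?_
  rw [uIcc_of_le zero_le_one] at hs
  have : √s ^ (2 * k + 2) = s ^ (k + 1) := by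
    rw [show 2 * k + 2 = 2 * (k + 1) by ring, pow_mul, Real.sq_sqrt hs.1]
  simp only [mul_pow, this]
  ring

/-- The coefficients of the two power series agree by Legendre's duplication formula at `k + 3/2`,
which trades `(k + 1)! / (2k + 2)!` for `1 / Γ(k + 3/2)`. -/
lemma struveH_eq {α z : ℝ} (hα : 1 / 2 < α) (hz : 0 < z) :
    struveH α z = (√Real.pi * Real.Gamma (α + 1 / 2))⁻¹ * (z / 2) ^ (α - 1) *
      struveProfile (α - 1 / 2) z := by
  have hπ : 0 < √Real.pi := Real.sqrt_pos.mpr Real.pi_pos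
  have hΓ : 0 < Real.Gamma (α + 1 / 2) := Real.Gamma_pos_of_pos (by linarith)
  have h := hasSum_struveProfile (β := α - 1 / 2) (by linarith) z
  have h2 := h.mul_left ((√Real.pi * Real.Gamma (α + 1 / 2))⁻¹ * ((z / 2) ^ 2)⁻¹)
  have key : ∑' k : ℕ, (-1 : ℝ) ^ k * (z / 2) ^ (2 * k) /
      (Real.Gamma ((k : ℝ) + 3 / 2) * Real.Gamma ((k : ℝ) + α + 3 / 2))
      = (√Real.pi * Real.Gamma (α + 1 / 2))⁻¹ * ((z / 2) ^ 2)⁻¹ *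
        struveProfile (α - 1 / 2) z := by
    rw [← h2.tsum_eq]
    refine tsum_congr fun k => ?_
    have h3 := Real.Gamma_mul_Gamma_add_half ((k : ℝ) + 3 / 2)
    have e1 : (k : ℝ) + 3 / 2 + 1 / 2 = ((k + 1 : ℕ) : ℝ) + 1 := by push_cast; ring
    have e2 : 2 * ((k : ℝ) + 3 / 2) = ((2 * k + 2 : ℕ) : ℝ) + 1 := by push_cast; ring
    have e3 : (2 : ℝ) ^ (1 - 2 * ((k : ℝ) + 3 / 2)) = ((2 : ℝ) ^ (2 * k + 2))⁻¹ := by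
      rw [← Real.rpow_natCast, ← Real.rpow_neg zero_le_two]
      congr 1; push_cast; ring
    rw [e3, e1, e2, Real.Gamma_nat_eq_factorial, Real.Gamma_nat_eq_factorial] at h3
    have e4 : ((k + 1 : ℕ) : ℝ) + 1 + (α - 1 / 2) = (k : ℝ) + α + 3 / 2 := by push_cast; ring
    have e5 : α - 1 / 2 + 1 = α + 1 / 2 := by ring
    rw [e4, e5]
    have g1 : 0 < Real.Gamma ((k : ℝ) + 3 / 2) := Real.Gamma_pos_of_pos (by positivity)
    have g2 : 0 < Real.Gamma ((k : ℝ) + α + 3 / 2) :=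
      Real.Gamma_pos_of_pos (by have : (0 : ℝ) ≤ k := k.cast_nonneg
                                linarith)
    have g3 : (0 : ℝ) < (2 * k + 2).factorial := by positivity
    have h4 : ((k + 1).factorial : ℝ) / (2 * k + 2).factorial
        = ((2 : ℝ) ^ (2 * k + 2))⁻¹ * √Real.pi / Real.Gamma ((k : ℝ) + 3 / 2) := by
      rw [div_eq_div_iff g3.ne' g1.ne']
      linarith
    have h5 : (-1 : ℝ) ^ k * z ^ (2 * k + 2) / (2 * k + 2).factorial *
        ((k + 1).factorial * Real.Gamma (α + 1 / 2) / Real.Gamma ((k : ℝ) + α + 3 / 2))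
        = (-1 : ℝ) ^ k * z ^ (2 * k + 2) * (((k + 1).factorial : ℝ) / (2 * k + 2).factorial) *
          (Real.Gamma (α + 1 / 2) / Real.Gamma ((k : ℝ) + α + 3 / 2)) := by ring
    rw [h5, h4, div_pow z 2 (2 * k), pow_add 2, pow_add z]
    field_simp
  have e6 : (z / 2) ^ (α + 1) = (z / 2) ^ (α - 1) * (z / 2) ^ 2 := by
    rw [← Real.rpow_natCast, ← Real.rpow_add (by positivity)]
    congr 1; push_cast; ring
  rw [struveH, key, e6]
  field_simp

/-! ### Two-sided bounds for the kernel -/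

lemma intervalIntegrable_struveProfile {β : ℝ} (hβ : 0 < β) (z : ℝ) :
    IntervalIntegrable (fun s => (1 - Real.cos (z * √s)) * struveDensity β s) volume 0 1 :=
  (intervalIntegrable_struveDensity hβ).continuousOn_mul (by fun_prop)

lemma integral_struveDensity {β : ℝ} (hβ : 0 < β) :
    ∫ s in (0 : ℝ)..1, struveDensity β s = 1 := by
  have := integral_pow_mul_struveDensity hβ 0
  simp only [pow_zero, one_mul, Nat.factorial_zero, Nat.cast_one, Nat.cast_zero, zero_add] at this
  rw [this, add_comm, div_self (Real.Gamma_pos_of_pos (by linarith)).ne']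

lemma struveProfile_le {β : ℝ} (hβ : 0 < β) (z : ℝ) :
    struveProfile β z ≤ 2 * min 1 (z ^ 2) := by
  have h : struveProfile β z ≤ ∫ s in (0 : ℝ)..1, (2 * min 1 (z ^ 2)) * struveDensity β s := by
    refine intervalIntegral.integral_mono_on zero_le_one (intervalIntegrable_struveProfile hβ z)
      ((intervalIntegrable_struveDensity hβ).const_mul _) fun s hs => ?_
    refine mul_le_mul_of_nonneg_right ?_ (struveDensity_nonneg hβ hs.2)
    rw [mul_min_of_nonneg _ _ zero_le_two]
    refine le_min (by linarith [Real.neg_one_le_cos (z * √s)]) ?_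
    have h1 := Real.one_sub_sq_div_two_le_cos (x := z * √s)
    rw [mul_pow, Real.sq_sqrt hs.1] at h1
    nlinarith [mul_le_mul_of_nonneg_left hs.2 (sq_nonneg z), sq_nonneg z]
  rwa [intervalIntegral.integral_const_mul, integral_struveDensity hβ, mul_one] at h

lemma continuous_struveProfile {β : ℝ} (hβ : 0 < β) : Continuous (struveProfile β) := by
  refine intervalIntegral.continuous_of_dominated_interval
    (bound := fun s => 2 * struveDensity β s) (fun z => ?_) (fun z => ?_) ?_ ?_
  · have := measurable_struveDensity β
    exact Measurable.aestronglyMeasurable (by fun_prop)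
  · refine Eventually.of_forall fun s hs => ?_
    rw [uIoc_of_le zero_le_one] at hs
    have h0 := struveDensity_nonneg hβ hs.2
    rw [norm_mul, Real.norm_of_nonneg h0]
    refine mul_le_mul_of_nonneg_right ?_ h0
    rw [Real.norm_of_nonneg (by linarith [Real.cos_le_one (z * √s)])]
    linarith [Real.neg_one_le_cos (z * √s)]
  · exact (intervalIntegrable_struveDensity hβ).const_mul _
  · exact Eventually.of_forall fun s _ => by fun_prop

/-- A quantitative form of `|sin w| < w` for positive `w`. -/
lemma abs_sin_le_mul {w : ℝ} (hw : 0 < w) : |Real.sin w| ≤ w * (1 - min 1 (w ^ 2) / 10) := by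
  rcases le_total w 1 with h | h
  · rw [abs_of_nonneg (Real.sin_nonneg_of_nonneg_of_le_pi hw.le (by linarith [Real.pi_gt_three]))]
    have h1 := (abs_le.mp (Real.sin_bound (x := w) (by rwa [abs_of_pos hw]))).2
    rw [abs_of_pos hw] at h1
    rw [min_eq_right (by nlinarith)]
    have h5 : w ^ 5 ≤ w ^ 3 := pow_le_pow_of_le_one hw.le h (by norm_num)
    nlinarith [pow_pos hw 3]
  · rw [min_eq_left (by nlinarith)]
    have h1 := (abs_le.mp (Real.sin_bound (x := 1) (by norm_num))).2
    norm_num at h1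
    rcases le_total w (10 / 9) with h2 | h2
    · have h3 : |Real.sin w - Real.sin 1| ≤ |w - 1| := by
        have := Real.abs_sin_sub_sin_le w 1
        exact this
      rw [abs_of_nonneg (sub_nonneg.mpr h)] at h3
      have h4 := (abs_le.mp h3).2
      rw [abs_of_nonneg (Real.sin_nonneg_of_nonneg_of_le_pi hw.le (by linarith [Real.pi_gt_three]))]
      linarith
    · linarith [Real.abs_sin_le_one w]

/-- With `s = t²` the Jacobian `2t` is at least `1` on `[1/2, 3/4]` and can be dropped. The
remaining integral is `1/4 - 2 sin (z/8) cos (5z/8) / z`, and the gain in `abs_sin_le_mul` at `z/8`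
leaves `min 1 ((z/8)^2) / 40`; hence `2560 = 40 * 64`. -/
lemma integral_one_sub_cos_ge {z : ℝ} (hz : 0 < z) :
    min 1 (z ^ 2) / 2560 ≤ ∫ s in (1 / 4 : ℝ)..(9 / 16), (1 - Real.cos (z * √s)) := by
  have hsub : ∫ t in (1 / 2 : ℝ)..(3 / 4), (1 - Real.cos (z * t)) * (2 * t)
      = ∫ s in (1 / 4 : ℝ)..(9 / 16), (1 - Real.cos (z * √s)) := by
    have := intervalIntegral.integral_comp_mul_deriv (a := 1 / 2) (b := 3 / 4)
      (f := fun t : ℝ => t ^ 2) (f' := fun t => 2 * t)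
      (g := fun s => 1 - Real.cos (z * √s)) (fun x _ => by simpa using hasDerivAt_pow 2 x)
      (by fun_prop) (by fun_prop)
    norm_num at this
    rw [← this]
    refine intervalIntegral.integral_congr fun t ht => ?_
    rw [uIcc_of_le (by norm_num)] at ht
    simp [Real.sqrt_sq (show 0 ≤ t by linarith [ht.1])]
  have hlow : ∫ t in (1 / 2 : ℝ)..(3 / 4), (1 - Real.cos (z * t))
      ≤ ∫ t in (1 / 2 : ℝ)..(3 / 4), (1 - Real.cos (z * t)) * (2 * t) := by
    refine intervalIntegral.integral_mono_on (by norm_num)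
      (Continuous.intervalIntegrable (by fun_prop) _ _)
      (Continuous.intervalIntegrable (by fun_prop) _ _) fun t ht => ?_
    exact le_mul_of_one_le_right (by linarith [Real.cos_le_one (z * t)]) (by linarith [ht.1])
  have hint : ∫ t in (1 / 2 : ℝ)..(3 / 4), (1 - Real.cos (z * t))
      = 1 / 4 - z⁻¹ * (Real.sin (z * (3 / 4)) - Real.sin (z * (1 / 2))) := by
    rw [intervalIntegral.integral_sub (by simp) (Continuous.intervalIntegrable (by fun_prop) _ _),
      intervalIntegral.integral_comp_mul_left _ hz.ne', integral_cos]
    norm_num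
  have hs : Real.sin (z * (3 / 4)) - Real.sin (z * (1 / 2))
      ≤ 2 * (z / 8 * (1 - min 1 ((z / 8) ^ 2) / 10)) := by
    rw [Real.sin_sub_sin]
    have e : (z * (3 / 4) - z * (1 / 2)) / 2 = z / 8 := by ring
    rw [e]
    have h1 := abs_sin_le_mul (show 0 < z / 8 by positivity)
    have h2 := Real.abs_cos_le_one ((z * (3 / 4) + z * (1 / 2)) / 2)
    have h3 : Real.sin (z / 8) * Real.cos ((z * (3 / 4) + z * (1 / 2)) / 2) ≤ |Real.sin (z / 8)| := by
      refine (le_abs_self _).trans ?_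
      rw [abs_mul]
      exact mul_le_of_le_one_right (abs_nonneg _) h2
    nlinarith
  have hs' : z⁻¹ * (Real.sin (z * (3 / 4)) - Real.sin (z * (1 / 2)))
      ≤ 1 / 4 * (1 - min 1 ((z / 8) ^ 2) / 10) := by
    refine (mul_le_mul_of_nonneg_left hs (by positivity)).trans (le_of_eq ?_)
    field_simp; ring
  have hm : min 1 (z ^ 2) / 64 ≤ min 1 ((z / 8) ^ 2) := by
    refine le_min ?_ ?_
    · linarith [min_le_left 1 (z ^ 2)]
    · linarith [min_le_right 1 (z ^ 2)]
  linarith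

/-- The interval `[1/4, 9/16]` stays away from `s = 1`, where the density may vanish or blow up, so
the density has a positive minimum there. -/
lemma exists_le_struveProfile {β : ℝ} (hβ : 0 < β) :
    ∃ c > 0, ∀ z > 0, c * min 1 (z ^ 2) ≤ struveProfile β z := by
  have hcont : ContinuousOn (struveDensity β) (Icc (1 / 4) (9 / 16)) := by
    refine ContinuousOn.mul continuousOn_const (ContinuousOn.rpow_const (by fun_prop) ?_)
    exact fun s hs => Or.inl (by linarith [hs.2])
  obtain ⟨s₀, hs₀, hmin⟩ := isCompact_Icc.exists_isMinOn (by simp; norm_num) hcont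
  have hm : 0 < struveDensity β s₀ := mul_pos hβ (Real.rpow_pos_of_pos (by linarith [hs₀.2]) _)
  refine ⟨struveDensity β s₀ / 2560, by positivity, fun z hz => ?_⟩
  have h1 := intervalIntegral.integral_mono_interval (c := 0) (a := 1 / 4) (b := 9 / 16) (d := 1)
    (by norm_num) (by norm_num) (by norm_num)
    (f := fun s => (1 - Real.cos (z * √s)) * struveDensity β s) (μ := volume)
    (by
      filter_upwards [ae_restrict_mem measurableSet_Ioc] with s hs
      exact mul_nonneg (by linarith [Real.cos_le_one (z * √s)]) (struveDensity_nonneg hβ hs.2))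
    (intervalIntegrable_struveProfile hβ z)
  have h2 : ∫ s in (1 / 4 : ℝ)..(9 / 16), (1 - Real.cos (z * √s)) * struveDensity β s₀
      ≤ ∫ s in (1 / 4 : ℝ)..(9 / 16), (1 - Real.cos (z * √s)) * struveDensity β s := by
    refine intervalIntegral.integral_mono_on (by norm_num)
      (Continuous.intervalIntegrable (by fun_prop) _ _)
      ((intervalIntegrable_struveProfile hβ z).mono_set ?_) fun s hs => ?_
    · rw [uIcc_of_le (by norm_num), uIcc_of_le zero_le_one]
      exact Icc_subset_Icc (by norm_num) (by norm_num)
    · exact mul_le_mul_of_nonneg_left (hmin hs) (by linarith [Real.cos_le_one (z * √s)])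
  rw [intervalIntegral.integral_mul_const] at h2
  have h3 := mul_le_mul_of_nonneg_right (integral_one_sub_cos_ge hz) hm.le
  calc struveDensity β s₀ / 2560 * min 1 (z ^ 2)
      = min 1 (z ^ 2) / 2560 * struveDensity β s₀ := by ring
    _ ≤ _ := h3.trans (h2.trans h1)

/-- The size of the Struve kernel: `z^(α + 3/2)` for `z ≤ 1` and `z^(α - 1/2)` for `z ≥ 1`. -/
lemma exists_struveKernel_bounds {α : ℝ} (hα : 1 / 2 < α) :
    ∃ c > 0, ∃ C > 0, ∀ x > 0, ∀ y > 0,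
      c * ((x * y) ^ (α - 1 / 2) * min 1 ((x * y) ^ 2)) ≤ struveKernel α x y ∧
      struveKernel α x y ≤ C * ((x * y) ^ (α - 1 / 2) * min 1 ((x * y) ^ 2)) := by
  have hΓ : 0 < Real.Gamma (α + 1 / 2) := Real.Gamma_pos_of_pos (by linarith)
  have hβ : 0 < α - 1 / 2 := by linarith
  obtain ⟨c, hc, hlow⟩ := exists_le_struveProfile hβ
  have hπ := Real.pi_pos
  set d : ℝ := (√Real.pi * Real.Gamma (α + 1 / 2))⁻¹ * ((2 : ℝ) ^ (α - 1))⁻¹ with hd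
  have hd0 : 0 < d := by positivity
  have key : ∀ z > 0, z ^ (1 / 2 : ℝ) * struveH α z
      = d * z ^ (α - 1 / 2) * struveProfile (α - 1 / 2) z := by
    intro z hz
    rw [struveH_eq hα hz, Real.div_rpow hz.le zero_le_two,
      show α - 1 / 2 = 1 / 2 + (α - 1) by ring, Real.rpow_add hz, hd, div_eq_mul_inv]
    ring
  refine ⟨d * c, by positivity, d * 2, by positivity, fun x hx y hy => ?_⟩
  have hz : 0 < x * y := mul_pos hx hy
  rw [struveKernel, key _ hz]
  have hp : 0 < d * (x * y) ^ (α - 1 / 2) := by positivity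
  constructor
  · calc _ = d * (x * y) ^ (α - 1 / 2) * (c * min 1 ((x * y) ^ 2)) := by ring
      _ ≤ _ := mul_le_mul_of_nonneg_left (hlow _ hz) hp.le
  · calc _ ≤ d * (x * y) ^ (α - 1 / 2) * (2 * min 1 ((x * y) ^ 2)) :=
        mul_le_mul_of_nonneg_left (struveProfile_le hβ _) hp.le
      _ = _ := by ring

/-- Measurability is read off from the continuous profile instead of the series. -/
lemma aestronglyMeasurable_struveKernel {α : ℝ} (hα : 1 / 2 < α) {y : ℝ} (hy : 0 < y) :
    AEStronglyMeasurable (fun x => struveKernel α x y) (volume.restrict (Ioi 0)) := by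
  have hc := (continuous_struveProfile (β := α - 1 / 2) (by linarith)).measurable
  have hm : Measurable fun x : ℝ => (x * y) ^ (1 / 2 : ℝ) *
      ((√Real.pi * Real.Gamma (α + 1 / 2))⁻¹ * (x * y / 2) ^ (α - 1) *
        struveProfile (α - 1 / 2) (x * y)) := by fun_prop
  refine hm.aestronglyMeasurable.congr ?_
  filter_upwards [ae_restrict_mem measurableSet_Ioi] with x hx
  rw [struveKernel, struveH_eq hα (mul_pos hx hy)]

/-! ### The weighted Hardy inequality -/

lemma measure_Iio_eq_iSup_rat (m : Measure ℝ) (b : ℝ) :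
    m (Iio b) = ⨆ t : {t : ℚ // (t : ℝ) < b}, m (Iio (t : ℝ)) := by
  rw [← Directed.measure_iUnion]
  · congr 1
    ext x
    simp only [mem_Iio, mem_iUnion, Subtype.exists, exists_prop]
    constructor
    · intro h
      obtain ⟨t, h1, h2⟩ := exists_rat_btwn h
      exact ⟨t, h2, h1⟩
    · rintro ⟨t, h1, h2⟩
      exact h2.trans h1
  · intro s t
    rcases le_total (s : ℚ) t with h | h
    · exact ⟨t, Iio_subset_Iio (by exact_mod_cast h), subset_rfl⟩
    · exact ⟨s, subset_rfl, Iio_subset_Iio (by exact_mod_cast h)⟩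

/-- The first point at which the distribution function of a measure without atoms reaches `c`. -/
lemma exists_measure_Iio_eq {m : Measure ℝ} (hm : ∀ t, m {t} = 0) {b : ℝ} {c : ℝ≥0∞}
    (hc : 0 < c) (hcb : c < m (Iio b)) (hb : m (Iio b) ≠ ∞) :
    ∃ t < b, m (Iio t) = c ∧ ∀ t' < t, m (Iio t') < c := by
  set S : Set ℝ := {t | m (Iio t) < c} with hS
  have hmono : Monotone fun t : ℝ => m (Iio t) := fun s t h => measure_mono (Iio_subset_Iio h)
  have hne : S.Nonempty := by
    have h := tendsto_measure_iInter_atTop (μ := m) (s := fun n : ℕ => Iio (b - n))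
      (fun n => measurableSet_Iio.nullMeasurableSet)
      (fun i j hij => Iio_subset_Iio (by have : (i : ℝ) ≤ j := by exact_mod_cast hij
                                         linarith)) ⟨0, by simpa using hb⟩
    have he : ⋂ n : ℕ, Iio (b - (n : ℝ)) = ∅ := by
      ext x
      simp only [mem_iInter, mem_Iio, mem_empty_iff_false, iff_false, not_forall, not_lt]
      obtain ⟨n, hn⟩ := exists_nat_ge (b - x)
      exact ⟨n, by linarith⟩
    rw [he, measure_empty] at h
    obtain ⟨n, hn⟩ := (h.eventually_lt_const hc).exists
    exact ⟨_, hn⟩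
  have hbdd : ∀ t ∈ S, t ≤ b := fun t ht => by
    by_contra! h
    exact absurd (hmono h.le) (not_le.mpr (lt_trans ht hcb))
  have hlub : IsLUB S (sSup S) := isLUB_csSup hne ⟨b, hbdd⟩
  set t := sSup S
  have hlt : ∀ t' < t, m (Iio t') < c := fun t' ht' => by
    obtain ⟨s, hs, h⟩ := (lt_isLUB_iff hlub).mp ht'
    exact lt_of_le_of_lt (hmono h.le) hs
  have hle : m (Iio t) ≤ c := by
    rw [measure_Iio_eq_iSup_rat]
    exact iSup_le fun s => (hlt _ s.2).le
  have htb : t < b := by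
    refine lt_of_le_of_ne (hlub.2 hbdd) fun h => ?_
    rw [h] at hle
    exact absurd hcb (not_lt.mpr hle)
  refine ⟨t, htb, le_antisymm hle ?_, hlt⟩
  -- Points to the right of `t` have distribution at least `c`. Continuity from above, available
  -- because `m (Iio b)` is finite, carries this to `Iic t`, and the point `t` has no mass.
  obtain ⟨v, hv, hvm, hvt⟩ := exists_seq_strictAnti_tendsto' htb
  have h := tendsto_measure_iInter_atTop (μ := m) (s := fun n : ℕ => Iio (v n))
      (fun n => measurableSet_Iio.nullMeasurableSet)
      (fun i j hij => Iio_subset_Iio (hv.antitone hij))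
      ⟨0, ne_top_of_le_ne_top hb (hmono (hvm 0).2.le)⟩
  have he : ⋂ n : ℕ, Iio (v n) = Iic t := by
    ext x
    simp only [mem_iInter, mem_Iio, mem_Iic]
    exact ⟨fun hx => ge_of_tendsto' hvt fun n => (hx n).le, fun hx n => hx.trans_lt (hvm n).1⟩
  rw [he] at h
  have h2 : c ≤ m (Iic t) := ge_of_tendsto' h fun n => by
    by_contra! hn
    exact absurd (hlub.1 hn) (not_le.mpr (hvm n).1)
  rw [← Iio_union_right] at h2
  refine h2.trans ((measure_union_le _ _).trans ?_)
  rw [hm t, add_zero]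

/-- In each term the factor `a i ^ (θ - 1)` is at most the same power of the whole sum. Used with `θ
= q / p`, this is where `p ≤ q` enters the Hardy inequality. -/
lemma ENNReal.tsum_rpow_le_rpow_tsum {ι : Type*} (a : ι → ℝ≥0∞) {θ : ℝ} (hθ : 1 ≤ θ) :
    ∑' i, a i ^ θ ≤ (∑' i, a i) ^ θ := by
  have hs : ∀ x : ℝ≥0∞, x ^ θ = x * x ^ (θ - 1) := fun x => by
    conv_lhs => rw [show θ = 1 + (θ - 1) by ring]
    rw [ENNReal.rpow_add_of_nonneg _ _ zero_le_one (by linarith), ENNReal.rpow_one]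
  rw [hs (∑' i, a i), ← ENNReal.tsum_mul_right]
  refine ENNReal.tsum_le_tsum fun i => ?_
  rw [hs]
  exact mul_le_mul' le_rfl (ENNReal.rpow_le_rpow (ENNReal.le_tsum i) (by linarith))

/-- Hölder's inequality for the integral of a product. -/
lemma lintegral_enorm_mul_enorm_le {X : Type*} [MeasurableSpace X] {μ : Measure X}
    {p p' : ℝ≥0∞} [ENNReal.HolderConjugate p' p] {W ψ : X → ℝ}
    (hW : AEStronglyMeasurable W μ) (hψ : AEStronglyMeasurable ψ μ) :
    ∫⁻ x, ‖W x‖ₑ * ‖ψ x‖ₑ ∂μ ≤ eLpNorm W p' μ * eLpNorm ψ p μ := by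
  have h := eLpNorm_smul_le_mul_eLpNorm (p := p') (q := p) (r := 1) hψ hW
  rw [eLpNorm_one_eq_lintegral_enorm] at h
  simpa [enorm_mul] using h

section Hardy

variable {X Y : Type*} [MeasurableSpace X] [MeasurableSpace Y]

/-- For `q = ∞` Hölder on `{r < t}` suffices for each `t < s y`, followed by the supremum over `t`.
Rational `t` keep the exceptional null sets countable in number. -/
lemma hardy_top {μ : Measure X} {ν : Measure Y} {r : X → ℝ} {s : Y → ℝ}
    (hr : Measurable r) (hs : Measurable s)
    {p p' : ℝ≥0∞} [ENNReal.HolderConjugate p' p] {W ψ : X → ℝ} {U : Y → ℝ}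
    (hW : AEStronglyMeasurable W μ) (hψ : AEStronglyMeasurable ψ μ) {A : ℝ≥0∞}
    (hA : ∀ t, eLpNorm U ∞ (ν.restrict (s ⁻¹' Ioi t)) *
      eLpNorm W p' (μ.restrict (r ⁻¹' Iio t)) ≤ A) :
    eLpNorm (fun y => ‖U y‖ₑ * ∫⁻ x in r ⁻¹' Iio (s y), ‖W x‖ₑ * ‖ψ x‖ₑ ∂μ) ∞ ν
      ≤ A * eLpNorm ψ p μ := by
  set g : X → ℝ≥0∞ := fun x => ‖W x‖ₑ * ‖ψ x‖ₑ
  set m : Measure ℝ := Measure.map r (μ.withDensity g) with hm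
  have hΦ : ∀ t, m (Iio t) = ∫⁻ x in r ⁻¹' Iio t, g x ∂μ := fun t => by
    rw [hm, Measure.map_apply hr measurableSet_Iio, withDensity_apply _ (hr measurableSet_Iio)]
  rw [eLpNorm_exponent_top]
  refine essSup_le_of_ae_le _ ?_
  have h1 : ∀ᵐ y ∂ν, ∀ t : ℚ, (t : ℝ) < s y →
      ‖U y‖ₑ ≤ eLpNorm U ∞ (ν.restrict (s ⁻¹' Ioi (t : ℝ))) := by
    rw [ae_all_iff]
    intro t
    rw [eLpNorm_exponent_top]
    exact (ae_restrict_iff' (hs measurableSet_Ioi)).mp ae_le_essSup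
  filter_upwards [h1] with y hy
  rw [enorm_eq_self, ← hΦ, measure_Iio_eq_iSup_rat, ENNReal.mul_iSup]
  refine iSup_le fun t => ?_
  rw [hΦ]
  calc _ ≤ eLpNorm U ∞ (ν.restrict (s ⁻¹' Ioi (t : ℝ))) *
        (eLpNorm W p' (μ.restrict (r ⁻¹' Iio (t : ℝ))) *
          eLpNorm ψ p (μ.restrict (r ⁻¹' Iio (t : ℝ)))) :=
        mul_le_mul' (hy t t.2) (lintegral_enorm_mul_enorm_le hW.restrict hψ.restrict)
    _ ≤ A * eLpNorm ψ p μ := by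
        rw [← mul_assoc]
        exact mul_le_mul' (hA _) (eLpNorm_mono_measure _ Measure.restrict_le_self)

/-- Let `Φ t` be the integral of `|W ψ|` over `{r < t}`. Where `Φ (s y)` lies in `(2^k, 2^(k+1)]`,
it is at most four times the mass `2^(k-1)` that `Φ` gains between the levels `2^(k-1)` and `2^k`.
Hölder bounds that mass using `ψ` only on `I k`; the sets `I k` are disjoint, so the pieces can be
summed. The maps `r` and `s` let one proof serve both directions of integration. -/
lemma hardy_of_ne_top {μ : Measure X} {ν : Measure Y} {r : X → ℝ} {s : Y → ℝ}
    (hr : Measurable r) (hs : Measurable s) (hr0 : ∀ t, μ (r ⁻¹' {t}) = 0)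
    {p p' q : ℝ≥0∞} [ENNReal.HolderConjugate p' p] (hp : 1 ≤ p) (hpq : p ≤ q) (hq : q ≠ ∞)
    {W ψ : X → ℝ} {U : Y → ℝ}
    (hW : AEStronglyMeasurable W μ) (hψ : AEStronglyMeasurable ψ μ) {A : ℝ≥0∞}
    (hA : ∀ t, eLpNorm U q (ν.restrict (s ⁻¹' Ioi t)) *
      eLpNorm W p' (μ.restrict (r ⁻¹' Iio t)) ≤ A)
    (hF : ∀ᵐ y ∂ν, ∫⁻ x in r ⁻¹' Iio (s y), ‖W x‖ₑ * ‖ψ x‖ₑ ∂μ ≠ ∞) :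
    eLpNorm (fun y => ‖U y‖ₑ * ∫⁻ x in r ⁻¹' Iio (s y), ‖W x‖ₑ * ‖ψ x‖ₑ ∂μ) q ν
      ≤ 4 * A * eLpNorm ψ p μ := by
  set g : X → ℝ≥0∞ := fun x => ‖W x‖ₑ * ‖ψ x‖ₑ
  set m : Measure ℝ := Measure.map r (μ.withDensity g) with hm
  have hΦ : ∀ t, m (Iio t) = ∫⁻ x in r ⁻¹' Iio t, g x ∂μ := fun t => by
    rw [hm, Measure.map_apply hr measurableSet_Iio, withDensity_apply _ (hr measurableSet_Iio)]
  have hm0 : ∀ t, m {t} = 0 := fun t => by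
    rw [hm, Measure.map_apply hr (measurableSet_singleton t),
      withDensity_apply _ (hr (measurableSet_singleton t))]
    exact setLIntegral_measure_zero _ _ (hr0 t)
  have hmono : Monotone fun t : ℝ => m (Iio t) := fun s t h => measure_mono (Iio_subset_Iio h)
  have hmeas : Measurable fun t : ℝ => m (Iio t) := hmono.measurable
  simp_rw [← hΦ] at hF ⊢
  have hp0 : p ≠ 0 := (zero_lt_one.trans_le hp).ne'
  have hq0 : q ≠ 0 := ((zero_lt_one.trans_le hp).trans_le hpq).ne'
  have hpt : p ≠ ∞ := ne_top_of_le_ne_top hq hpq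
  have hP : 0 < p.toReal := ENNReal.toReal_pos hp0 hpt
  have hQ : 0 < q.toReal := ENNReal.toReal_pos hq0 hq
  have hPQ : 1 ≤ q.toReal / p.toReal := by
    rw [one_le_div hP]; exact ENNReal.toReal_mono hq hpq
  set L : ℤ → Set Y := fun k => {y | m (Iio (s y)) ∈ Ioc ((2 : ℝ≥0∞) ^ k) (2 ^ (k + 1))} with hL
  have hLm : ∀ k, MeasurableSet (L k) := fun k => (hmeas.comp hs) measurableSet_Ioc
  set I : ℤ → Set X := fun k => {x | m (Iio (r x)) ∈ Ico ((2 : ℝ≥0∞) ^ (k - 1)) (2 ^ k)} with hI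
  have hIm : ∀ k, MeasurableSet (I k) := fun k => (hmeas.comp hr) measurableSet_Ico
  have hId : Pairwise (Function.onFun Disjoint I) := by
    have hlt : ∀ i j : ℤ, i < j → Disjoint (I i) (I j) := fun i j hij => by
      refine Set.disjoint_left.mpr fun x hi hj => ?_
      have h1 : (2 : ℝ≥0∞) ^ i ≤ 2 ^ (j - 1) :=
        ENNReal.zpow_le_of_le one_le_two (by omega)
      exact absurd (hi.2.trans_le (h1.trans hj.1)) (lt_irrefl _)
    intro i j hij
    rcases lt_or_gt_of_ne hij with h | h
    · exact hlt i j h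
    · exact (hlt j i h).symm
  set a : ℤ → ℝ≥0∞ := fun k => ∫⁻ x in I k, ‖ψ x‖ₑ ^ p.toReal ∂μ with ha
  have hpiece : ∀ k, ∫⁻ y in L k, (‖U y‖ₑ * m (Iio (s y))) ^ q.toReal ∂ν
      ≤ (4 * A) ^ q.toReal * a k ^ (q.toReal / p.toReal) := by
    intro k
    rcases (L k).eq_empty_or_nonempty with h0 | ⟨y₀, hy₀⟩
    · rw [h0]; simp
    have h2k : ∀ j : ℤ, (0 : ℝ≥0∞) < 2 ^ j := fun j =>
      ENNReal.zpow_pos two_ne_zero ENNReal.ofNat_ne_top j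
    have h2k' : ∀ j : ℤ, (2 : ℝ≥0∞) ^ j ≠ ∞ := fun j =>
      ENNReal.zpow_ne_top two_ne_zero ENNReal.ofNat_ne_top j
    -- Taking the first point at level `2^k` gives strict inequality to its left, which places `r
    -- ⁻¹' Ico t' t` inside `I k`.
    obtain ⟨t, -, ht, htlt⟩ := exists_measure_Iio_eq hm0 (h2k k) hy₀.1
      (ne_top_of_le_ne_top (h2k' _) hy₀.2)
    have hdouble : ∀ j : ℤ, (2 : ℝ≥0∞) ^ (j + 1) = 2 ^ j * 2 := fun j => by
      rw [ENNReal.zpow_add two_ne_zero ENNReal.ofNat_ne_top, zpow_one]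
    have hhalf : (2 : ℝ≥0∞) ^ k = 2 ^ (k - 1) + 2 ^ (k - 1) := by
      rw [← mul_two, ← hdouble, sub_add_cancel]
    obtain ⟨t', htt', ht', -⟩ := exists_measure_Iio_eq hm0 (h2k (k - 1))
      (b := t) (by
        rw [ht, hhalf]
        exact ENNReal.lt_add_right (h2k' _) (h2k _).ne') (by rw [ht]; exact h2k' k)
    have hJ : ∫⁻ x in r ⁻¹' Ico t' t, g x ∂μ = 2 ^ (k - 1) := by
      rw [← withDensity_apply _ (hr measurableSet_Ico), ← Measure.map_apply hr measurableSet_Ico,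
        ← hm, show Ico t' t = Iio t \ Iio t' by ext x; simp, measure_sdiff (Iio_subset_Iio htt'.le)
        measurableSet_Iio.nullMeasurableSet (by rw [ht']; exact h2k' _), ht, ht', hhalf]
      exact ENNReal.add_sub_cancel_right (h2k' _)
    have hJI : r ⁻¹' Ico t' t ⊆ I k := fun x hx =>
      ⟨by rw [← ht']; exact hmono hx.1, htlt _ hx.2⟩
    have hJt : r ⁻¹' Ico t' t ⊆ r ⁻¹' Iio t := preimage_mono Ico_subset_Iio_self
    have hψI : eLpNorm ψ p (μ.restrict (I k)) = a k ^ (1 / p.toReal) := by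
      rw [eLpNorm_eq_lintegral_rpow_enorm_toReal hp0 hpt]
    have hbound : (2 : ℝ≥0∞) ^ (k + 1) ≤
        4 * (eLpNorm W p' (μ.restrict (r ⁻¹' Iio t)) * a k ^ (1 / p.toReal)) := by
      have : (2 : ℝ≥0∞) ^ (k + 1) = 4 * 2 ^ (k - 1) := by
        rw [hdouble, hhalf, ← mul_two]; ring
      rw [this, ← hJ, ← hψI]
      gcongr
      refine (lintegral_enorm_mul_enorm_le (p := p) (p' := p') hW.restrict hψ.restrict).trans ?_
      exact mul_le_mul' (eLpNorm_mono_measure _ (Measure.restrict_mono hJt le_rfl))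
        (eLpNorm_mono_measure _ (Measure.restrict_mono hJI le_rfl))
    have hLt : L k ⊆ s ⁻¹' Ioi t := fun y hy => by
      by_contra! h
      have h1 : s y ≤ t := not_lt.mp h
      have h2 := hmono h1
      simp only [ht] at h2
      exact absurd hy.1 (not_lt.mpr h2)
    have hUt : eLpNorm U q (ν.restrict (s ⁻¹' Ioi t)) ^ q.toReal
        = ∫⁻ y in s ⁻¹' Ioi t, ‖U y‖ₑ ^ q.toReal ∂ν := by
      rw [eLpNorm_eq_lintegral_rpow_enorm_toReal hq0 hq, ← ENNReal.rpow_mul,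
        one_div_mul_cancel hQ.ne', ENNReal.rpow_one]
    calc ∫⁻ y in L k, (‖U y‖ₑ * m (Iio (s y))) ^ q.toReal ∂ν
        ≤ ∫⁻ y in L k, ‖U y‖ₑ ^ q.toReal * ((2 : ℝ≥0∞) ^ (k + 1)) ^ q.toReal ∂ν := by
          refine setLIntegral_mono' (hLm k) fun y hy => ?_
          rw [ENNReal.mul_rpow_of_nonneg _ _ hQ.le]
          gcongr
          exact hy.2
      _ = (∫⁻ y in L k, ‖U y‖ₑ ^ q.toReal ∂ν) * ((2 : ℝ≥0∞) ^ (k + 1)) ^ q.toReal :=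
          lintegral_mul_const' _ _ (ENNReal.rpow_ne_top_of_nonneg hQ.le (h2k' _))
      _ ≤ eLpNorm U q (ν.restrict (s ⁻¹' Ioi t)) ^ q.toReal *
          (4 * (eLpNorm W p' (μ.restrict (r ⁻¹' Iio t)) * a k ^ (1 / p.toReal))) ^ q.toReal := by
          rw [hUt]
          gcongr
      _ = (4 * (eLpNorm U q (ν.restrict (s ⁻¹' Ioi t)) *
            eLpNorm W p' (μ.restrict (r ⁻¹' Iio t))) * a k ^ (1 / p.toReal)) ^ q.toReal := by
          rw [← ENNReal.mul_rpow_of_nonneg _ _ hQ.le]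
          congr 1; ring
      _ ≤ (4 * A * a k ^ (1 / p.toReal)) ^ q.toReal := by
          gcongr; exact hA t
      _ = (4 * A) ^ q.toReal * a k ^ (q.toReal / p.toReal) := by
          rw [ENNReal.mul_rpow_of_nonneg _ _ hQ.le, ← ENNReal.rpow_mul]
          congr 2; ring
  have htotal : ∫⁻ y, (‖U y‖ₑ * m (Iio (s y))) ^ q.toReal ∂ν
      ≤ (4 * A) ^ q.toReal * (∫⁻ x, ‖ψ x‖ₑ ^ p.toReal ∂μ) ^ (q.toReal / p.toReal) := by
    calc ∫⁻ y, (‖U y‖ₑ * m (Iio (s y))) ^ q.toReal ∂ν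
        ≤ ∫⁻ y, (⋃ k, L k).indicator (fun y => (‖U y‖ₑ * m (Iio (s y))) ^ q.toReal) y ∂ν := by
          refine lintegral_mono_ae ?_
          filter_upwards [hF] with y hy
          by_cases h0 : m (Iio (s y)) = 0
          · rw [h0, mul_zero, ENNReal.zero_rpow_of_pos hQ]; exact zero_le
          -- The dyadic levels miss only the values `0` and `∞`; `hF` excludes `∞` almost
          -- everywhere.
          · obtain ⟨k, hk⟩ := ENNReal.exists_mem_Ioc_zpow h0 hy ENNReal.one_lt_two
              ENNReal.ofNat_ne_top
            rw [indicator_of_mem (mem_iUnion.mpr ⟨k, hk⟩)]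
      _ ≤ ∫⁻ y in ⋃ k, L k, (‖U y‖ₑ * m (Iio (s y))) ^ q.toReal ∂ν := lintegral_indicator_le _ _
      _ ≤ ∑' k, ∫⁻ y in L k, (‖U y‖ₑ * m (Iio (s y))) ^ q.toReal ∂ν := lintegral_iUnion_le _ _
      _ ≤ ∑' k, (4 * A) ^ q.toReal * a k ^ (q.toReal / p.toReal) := ENNReal.tsum_le_tsum hpiece
      _ ≤ (4 * A) ^ q.toReal * (∑' k, a k) ^ (q.toReal / p.toReal) := by
          rw [ENNReal.tsum_mul_left]
          gcongr
          exact ENNReal.tsum_rpow_le_rpow_tsum a hPQ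
      _ ≤ _ := by
          gcongr
          rw [ha, ← lintegral_iUnion hIm hId]
          exact setLIntegral_le_lintegral _ _
  rw [eLpNorm_eq_lintegral_rpow_enorm_toReal hq0 hq, eLpNorm_eq_lintegral_rpow_enorm_toReal hp0 hpt]
  simp only [enorm_eq_self]
  refine (ENNReal.rpow_le_rpow htotal (by positivity)).trans (le_of_eq ?_)
  rw [ENNReal.mul_rpow_of_nonneg _ _ (by positivity), ← ENNReal.rpow_mul, ← ENNReal.rpow_mul,
    mul_one_div_cancel hQ.ne', ENNReal.rpow_one]
  congr 2
  field_simp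

/-- The weighted Hardy inequality for `p ≤ q`. -/
theorem hardy_inequality {μ : Measure X} {ν : Measure Y} {r : X → ℝ} {s : Y → ℝ}
    (hr : Measurable r) (hs : Measurable s) (hr0 : ∀ t, μ (r ⁻¹' {t}) = 0)
    {p p' q : ℝ≥0∞} [ENNReal.HolderConjugate p' p] (hp : 1 ≤ p) (hpq : p ≤ q)
    {W ψ : X → ℝ} {U : Y → ℝ}
    (hW : AEStronglyMeasurable W μ) (hψ : AEStronglyMeasurable ψ μ) {A : ℝ≥0∞}
    (hA : ∀ t, eLpNorm U q (ν.restrict (s ⁻¹' Ioi t)) *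
      eLpNorm W p' (μ.restrict (r ⁻¹' Iio t)) ≤ A)
    (hF : ∀ᵐ y ∂ν, ∫⁻ x in r ⁻¹' Iio (s y), ‖W x‖ₑ * ‖ψ x‖ₑ ∂μ ≠ ∞) :
    eLpNorm (fun y => ‖U y‖ₑ * ∫⁻ x in r ⁻¹' Iio (s y), ‖W x‖ₑ * ‖ψ x‖ₑ ∂μ) q ν
      ≤ 4 * A * eLpNorm ψ p μ := by
  rcases eq_or_ne q ∞ with rfl | hq
  · refine (hardy_top (p := p) hr hs hW hψ hA).trans ?_
    gcongr
    exact le_mul_of_one_le_left' (by norm_num)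
  · exact hardy_of_ne_top hr hs hr0 hp hpq hq hW hψ hA hF

end Hardy

/-! ### Sufficiency of the two conditions -/

/-- A nonzero norm of `U` in a product bounded by a finite `A` forces the norm of `W` to be finite,
and Hölder applies. Positivity of the weight supplies the nonzero norm, so the finiteness hypothesis
of `hardy_inequality` is automatic. -/
lemma lintegral_mul_ne_top_of_hardy {X Y : Type*} [MeasurableSpace X] [MeasurableSpace Y]
    {μ : Measure X} {ν : Measure Y} {r : X → ℝ} {s : Y → ℝ}
    {p p' q : ℝ≥0∞} [ENNReal.HolderConjugate p' p] {W ψ : X → ℝ} {U : Y → ℝ}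
    (hW : AEStronglyMeasurable W μ) (hψ : AEStronglyMeasurable ψ μ) {A : ℝ≥0∞}
    (hA : ∀ t, eLpNorm U q (ν.restrict (s ⁻¹' Ioi t)) *
      eLpNorm W p' (μ.restrict (r ⁻¹' Iio t)) ≤ A) (hA' : A ≠ ∞) (hψ' : eLpNorm ψ p μ ≠ ∞)
    {y : Y} (hy : eLpNorm U q (ν.restrict (s ⁻¹' Ioi (s y))) ≠ 0) :
    ∫⁻ x in r ⁻¹' Iio (s y), ‖W x‖ₑ * ‖ψ x‖ₑ ∂μ ≠ ∞ := by
  refine ne_top_of_le_ne_top ?_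
    (lintegral_enorm_mul_enorm_le (p := p) (p' := p') hW.restrict hψ.restrict)
  refine ENNReal.mul_ne_top (fun h => ?_)
    (ne_top_of_le_ne_top hψ' (eLpNorm_mono_measure _ Measure.restrict_le_self))
  have := hA (s y)
  rw [h, ENNReal.mul_top hy] at this
  exact hA' (top_le_iff.mp this)

lemma eLpNorm_ne_zero_of_pos {q : ℝ≥0∞} (hq : q ≠ 0) {S : Set ℝ} (hS : MeasurableSet S)
    (hvol : volume S ≠ 0) {U : ℝ → ℝ} (hU : AEStronglyMeasurable U (volume.restrict S))
    (hpos : ∀ x ∈ S, 0 < U x) : eLpNorm U q (volume.restrict S) ≠ 0 := by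
  intro h
  rw [eLpNorm_eq_zero_iff hU hq] at h
  have : ∀ᵐ x ∂volume.restrict S, False := by
    filter_upwards [h, ae_restrict_mem hS] with x hx hxS
    exact (hpos x hxS).ne' hx
  rw [ae_iff] at this
  simp at this
  exact hvol this

lemma enorm_struveTransform_le {𝕜 : Type*} [RCLike 𝕜] {α : ℝ} {f : ℝ → 𝕜}
    (hf : StruveTransformExists α f) {y : ℝ} (hy : 0 < y) :
    ‖struveTransform α f y‖ₑ ≤ ∫⁻ x in Ioi 0, ‖struveKernel α x y‖ₑ * ‖f x‖ₑ := by
  obtain ⟨-, l, hl⟩ := hf y hy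
  have hl' : struveTransform α f y = l := hl.limUnder_eq
  rw [hl']
  refine le_of_tendsto' hl.enorm fun N => ?_
  refine (enorm_integral_le_lintegral_enorm _).trans ?_
  simp_rw [enorm_smul]
  exact lintegral_mono_set Ioc_subset_Ioi_self

/-- The split is at `xy = 1`: `min 1 ((xy)^2)` is replaced by `(xy)^2` on the left and by `1` on the
right, so that both pieces factor in `x` and `y`. -/
lemma lintegral_struveKernel_le {α C : ℝ} (hC : 0 < C)
    (hK : ∀ x > 0, ∀ y > 0, ‖struveKernel α x y‖ₑ ≤
      ENNReal.ofReal (C * ((x * y) ^ (α - 1 / 2) * min 1 ((x * y) ^ 2))))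
    (g : ℝ → ℝ≥0∞) {y : ℝ} (hy : 0 < y) :
    ∫⁻ x in Ioi 0, ‖struveKernel α x y‖ₑ * g x ≤ ENNReal.ofReal C *
      (ENNReal.ofReal (y ^ (α + 3 / 2)) *
        ∫⁻ x in Iio (1 / y), ENNReal.ofReal (x ^ (α + 3 / 2)) * g x ∂volume.restrict (Ioi 0) +
      ENNReal.ofReal (y ^ (α - 1 / 2)) *
        ∫⁻ x in Ioi (1 / y), ENNReal.ofReal (x ^ (α - 1 / 2)) * g x ∂volume.restrict (Ioi 0)) := by
  rw [← lintegral_add_compl _ (measurableSet_Iio (a := 1 / y)), mul_add]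
  have hp : ∀ x > 0, (x * y) ^ (α - 1 / 2) = y ^ (α - 1 / 2) * x ^ (α - 1 / 2) := fun x hx => by
    rw [Real.mul_rpow hx.le hy.le, mul_comm]
  refine add_le_add ?_ ?_
  · rw [← lintegral_const_mul' _ _ ENNReal.ofReal_ne_top,
      ← lintegral_const_mul' _ _ ENNReal.ofReal_ne_top]
    refine lintegral_mono_ae ?_
    filter_upwards [ae_restrict_of_ae (ae_restrict_mem measurableSet_Ioi)] with x hx
    rw [← mul_assoc, ← mul_assoc, ← ENNReal.ofReal_mul hC.le,
      ← ENNReal.ofReal_mul (by positivity)]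
    refine mul_le_mul' ((hK x hx y hy).trans (ENNReal.ofReal_le_ofReal ?_)) le_rfl
    rw [mul_assoc]
    refine mul_le_mul_of_nonneg_left ?_ hC.le
    have h1 : ∀ w > (0 : ℝ), w ^ (α + 3 / 2) = w ^ (α - 1 / 2) * w ^ 2 := fun w hw => by
      rw [← Real.rpow_natCast, ← Real.rpow_add hw]; congr 1; push_cast; ring
    have hxp : 0 < x := hx
    calc _ ≤ (x * y) ^ (α - 1 / 2) * (x * y) ^ 2 := by
          gcongr; exact min_le_right _ _
      _ = _ := by rw [hp x hx, h1 x hx, h1 y hy]; ring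
  · rw [compl_Iio, Measure.restrict_congr_set (μ := volume.restrict (Ioi 0))
      (Ioi_ae_eq_Ici (a := 1 / y)).symm, ← lintegral_const_mul' _ _ ENNReal.ofReal_ne_top,
      ← lintegral_const_mul' _ _ ENNReal.ofReal_ne_top]
    refine lintegral_mono_ae ?_
    filter_upwards [ae_restrict_of_ae (ae_restrict_mem measurableSet_Ioi)] with x hx
    rw [← mul_assoc, ← mul_assoc, ← ENNReal.ofReal_mul hC.le,
      ← ENNReal.ofReal_mul (by positivity)]
    refine mul_le_mul' ((hK x hx y hy).trans (ENNReal.ofReal_le_ofReal ?_)) le_rfl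
    rw [mul_assoc]
    refine mul_le_mul_of_nonneg_left ?_ hC.le
    have hxp : 0 < x := hx
    calc _ ≤ (x * y) ^ (α - 1 / 2) * 1 := by
          gcongr; exact min_le_left _ _
      _ = _ := by rw [hp x hx, mul_one]

/-- The Hardy inequality for the integrals `∫_{x < 1/y}`. -/
lemma hardy_Iio {p q p' : ℝ≥0∞} [ENNReal.HolderConjugate p' p] (hp : 1 ≤ p) (hpq : p ≤ q)
    {W ψ U : ℝ → ℝ} (hW : AEStronglyMeasurable W (volume.restrict (Ioi 0)))
    (hψ : AEStronglyMeasurable ψ (volume.restrict (Ioi 0)))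
    (hU : AEStronglyMeasurable U (volume.restrict (Ioi 0))) (hpos : ∀ x > 0, 0 < U x)
    {A : ℝ≥0∞} (hA' : A ≠ ∞) (hψ' : eLpNorm ψ p (volume.restrict (Ioi 0)) ≠ ∞)
    (hA : ∀ t > 0, eLpNorm U q (volume.restrict (Ioo 0 (1 / t))) *
      eLpNorm W p' (volume.restrict (Ioo 0 t)) ≤ A) :
    eLpNorm (fun y => ‖U y‖ₑ * ∫⁻ x in Iio (1 / y), ‖W x‖ₑ * ‖ψ x‖ₑ ∂volume.restrict (Ioi 0))
      q (volume.restrict (Ioi 0)) ≤ 4 * A * eLpNorm ψ p (volume.restrict (Ioi 0)) := by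
  have hq : q ≠ 0 := ((zero_lt_one.trans_le hp).trans_le hpq).ne'
  have hs : Measurable fun y : ℝ => 1 / y := by fun_prop
  have hset : ∀ t > (0 : ℝ), (volume.restrict (Ioi (0 : ℝ))).restrict ((fun y => 1 / y) ⁻¹' Ioi t)
      = volume.restrict (Ioo 0 (1 / t)) := fun t ht => by
    rw [Measure.restrict_restrict (hs measurableSet_Ioi)]
    congr 1
    ext y
    simp only [mem_inter_iff, mem_preimage, mem_Ioi, mem_Ioo]
    constructor
    · rintro ⟨h1, h2⟩
      exact ⟨h2, (lt_one_div ht h2).mp h1⟩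
    · rintro ⟨h1, h2⟩
      exact ⟨(lt_one_div ht h1).mpr h2, h1⟩
  have hA2 : ∀ t : ℝ, eLpNorm U q ((volume.restrict (Ioi (0 : ℝ))).restrict
      ((fun y => 1 / y) ⁻¹' Ioi t)) *
      eLpNorm W p' ((volume.restrict (Ioi (0 : ℝ))).restrict ((fun x => x) ⁻¹' Iio t)) ≤ A := by
    intro t
    rw [preimage_id', Measure.restrict_restrict measurableSet_Iio, inter_comm, Ioi_inter_Iio]
    rcases le_or_gt t 0 with ht | ht
    · rw [Ioo_eq_empty (not_lt.mpr ht)]; simp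
    · rw [hset t ht]; exact hA t ht
  refine hardy_inequality (r := fun x => x) measurable_id hs (fun t => ?_) hp hpq hW hψ hA2 ?_
  · exact measure_mono_null (preimage_id'.subset) (by simp)
  · filter_upwards [ae_restrict_mem measurableSet_Ioi] with y hy
    have hy' : 0 < 1 / y := one_div_pos.mpr hy
    refine lintegral_mul_ne_top_of_hardy hW hψ hA2 hA' hψ' ?_
    rw [hset _ hy', one_div_one_div]
    exact eLpNorm_ne_zero_of_pos hq measurableSet_Ioo (by simpa using hy)
      (hU.mono_measure (Measure.restrict_mono Ioo_subset_Ioi_self le_rfl)) fun x hx => hpos x hx.1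

/-- The Hardy inequality for the integrals `∫_{x > 1/y}`. -/
lemma hardy_Ioi {p q p' : ℝ≥0∞} [ENNReal.HolderConjugate p' p] (hp : 1 ≤ p) (hpq : p ≤ q)
    {W ψ U : ℝ → ℝ} (hW : AEStronglyMeasurable W (volume.restrict (Ioi 0)))
    (hψ : AEStronglyMeasurable ψ (volume.restrict (Ioi 0)))
    (hU : AEStronglyMeasurable U (volume.restrict (Ioi 0))) (hpos : ∀ x > 0, 0 < U x)
    {A : ℝ≥0∞} (hA' : A ≠ ∞) (hψ' : eLpNorm ψ p (volume.restrict (Ioi 0)) ≠ ∞)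
    (hA : ∀ t > 0, eLpNorm U q (volume.restrict (Ioi (1 / t))) *
      eLpNorm W p' (volume.restrict (Ioi t)) ≤ A) :
    eLpNorm (fun y => ‖U y‖ₑ * ∫⁻ x in Ioi (1 / y), ‖W x‖ₑ * ‖ψ x‖ₑ ∂volume.restrict (Ioi 0))
      q (volume.restrict (Ioi 0)) ≤ 4 * A * eLpNorm ψ p (volume.restrict (Ioi 0)) := by
  have hq : q ≠ 0 := ((zero_lt_one.trans_le hp).trans_le hpq).ne'
  -- The reflections `r x = -x` and `s y = -(1 / y)` turn `x > 1/y` into `r x < s y`.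
  have hs : Measurable fun y : ℝ => -(1 / y) := by fun_prop
  have hset : ∀ t > (0 : ℝ), (volume.restrict (Ioi (0 : ℝ))).restrict
      ((fun y => -(1 / y)) ⁻¹' Ioi (-t)) = volume.restrict (Ioi (1 / t)) := fun t ht => by
    rw [Measure.restrict_restrict (hs measurableSet_Ioi)]
    congr 1
    ext y
    simp only [mem_inter_iff, mem_preimage, mem_Ioi, neg_lt_neg_iff]
    constructor
    · rintro ⟨h1, h2⟩
      exact (one_div_lt h2 ht).mp h1
    · intro h
      have h0 : 0 < y := (one_div_pos.mpr ht).trans h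
      exact ⟨(one_div_lt h0 ht).mpr h, h0⟩
  have hA2 : ∀ t : ℝ, eLpNorm U q ((volume.restrict (Ioi (0 : ℝ))).restrict
      ((fun y => -(1 / y)) ⁻¹' Ioi t)) *
      eLpNorm W p' ((volume.restrict (Ioi (0 : ℝ))).restrict ((fun x => -x) ⁻¹' Iio t)) ≤ A := by
    intro t
    rcases le_or_gt 0 t with ht | ht
    · have : (fun y : ℝ => -(1 / y)) ⁻¹' Ioi t ∩ Ioi 0 = ∅ := by
        ext y
        simp only [mem_inter_iff, mem_preimage, mem_Ioi, mem_empty_iff_false, iff_false, not_and]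
        intro h1 h2
        have := one_div_pos.mpr h2
        linarith
      rw [Measure.restrict_restrict (hs measurableSet_Ioi), this]; simp
    · have h1 : (fun x : ℝ => -x) ⁻¹' Iio t = Ioi (-t) := by ext x; simp
      have ht' : 0 < -t := by linarith
      have h2 := hset (-t) ht'
      rw [neg_neg] at h2
      rw [h2, h1, Measure.restrict_restrict measurableSet_Ioi, Ioi_inter_Ioi, sup_of_le_left ht'.le]
      exact hA (-t) ht'
  have hpre : ∀ y : ℝ, Ioi (1 / y) = (fun x : ℝ => -x) ⁻¹' Iio (-(1 / y)) := fun y => by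
    ext x; simp
  simp_rw [hpre]
  refine hardy_inequality (r := fun x => -x) measurable_neg hs (fun t => ?_) hp hpq hW hψ hA2 ?_
  · have : (fun x : ℝ => -x) ⁻¹' {t} = {-t} := by ext x; simp
    rw [this]
    simp
  · filter_upwards [ae_restrict_mem measurableSet_Ioi] with y hy
    have hy' : 0 < 1 / y := one_div_pos.mpr hy
    refine lintegral_mul_ne_top_of_hardy (s := fun y => -(1 / y)) hW hψ hA2 hA' hψ' ?_
    rw [hset _ hy', one_div_one_div]
    exact eLpNorm_ne_zero_of_pos hq measurableSet_Ioi (by simp)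
      (hU.mono_measure (Measure.restrict_mono (Ioi_subset_Ioi (le_of_lt hy)) le_rfl))
      fun x hx => hpos x (lt_trans hy hx)

lemma IsWeight.aestronglyMeasurable {w : ℝ → ℝ} (hw : IsWeight w) :
    AEStronglyMeasurable w (volume.restrict (Ioi 0)) :=
  hw.locallyIntegrable.aestronglyMeasurable

lemma IsWeight.aestronglyMeasurable_inv {w : ℝ → ℝ} (hw : IsWeight w) :
    AEStronglyMeasurable (fun x => (w x)⁻¹) (volume.restrict (Ioi 0)) :=
  hw.aestronglyMeasurable.aemeasurable.inv.aestronglyMeasurable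

lemma aestronglyMeasurable_rpow (a : ℝ) (μ : Measure ℝ) :
    AEStronglyMeasurable (fun x : ℝ => x ^ a) μ :=
  Measurable.aestronglyMeasurable (by fun_prop)

/-- The weighted norm inequality follows from the two Muckenhoupt type conditions. -/
theorem weightedNorm_struveTransform_le {𝕜 : Type*} [RCLike 𝕜] {α : ℝ} (hα : 1 / 2 < α)
    {p q p' : ℝ≥0∞} [ENNReal.HolderConjugate p' p] (hp : 1 ≤ p) (hpq : p ≤ q)
    {u v : ℝ → ℝ} (hu : IsWeight u) (hv : IsWeight v) {A B : ℝ≥0∞} (hA' : A ≠ ∞) (hB' : B ≠ ∞)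
    (hA : ∀ t > 0, eLpNorm (fun x => x ^ (α + 3 / 2) * u x) q (volume.restrict (Ioo 0 (1 / t))) *
      eLpNorm (fun x => x ^ (α + 3 / 2) * (v x)⁻¹) p' (volume.restrict (Ioo 0 t)) ≤ A)
    (hB : ∀ t > 0, eLpNorm (fun x => x ^ (α - 1 / 2) * u x) q (volume.restrict (Ioi (1 / t))) *
      eLpNorm (fun x => x ^ (α - 1 / 2) * (v x)⁻¹) p' (volume.restrict (Ioi t)) ≤ B) :
    ∃ C : ℝ≥0, 0 < C ∧ ∀ f : ℝ → 𝕜,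
        AEStronglyMeasurable f (volume.restrict (Ioi 0)) → StruveTransformExists α f →
          weightedNorm q u (struveTransform α f) ≤ C * weightedNorm p v f := by
  obtain ⟨c, hc, C, hC, hK⟩ := exists_struveKernel_bounds hα
  have hKe : ∀ x > 0, ∀ y > 0, ‖struveKernel α x y‖ₑ ≤
      ENNReal.ofReal (C * ((x * y) ^ (α - 1 / 2) * min 1 ((x * y) ^ 2))) := fun x hx y hy => by
    have h0 : 0 ≤ struveKernel α x y := le_trans (by positivity) (hK x hx y hy).1
    rw [Real.enorm_of_nonneg h0]
    exact ENNReal.ofReal_le_ofReal (hK x hx y hy).2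
  have hD : ENNReal.ofReal C * (4 * A + 4 * B) ≠ ∞ := by finiteness
  -- The summand `1` makes the constant positive even if `A = B = 0`, which also settles the case of
  -- infinite `weightedNorm p v f`.
  refine ⟨(ENNReal.ofReal C * (4 * A + 4 * B)).toNNReal + 1, by positivity, fun f hf hfe => ?_⟩
  rw [ENNReal.coe_add, ENNReal.coe_toNNReal hD]
  rcases eq_or_ne (weightedNorm p v f) ∞ with htop | htop
  · rw [htop, ENNReal.mul_top (by simp)]; exact le_top
  refine le_trans ?_ (mul_le_mul' le_self_add le_rfl)
  set ψ : ℝ → ℝ := fun x => v x * ‖f x‖ with hψd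
  have hψ : AEStronglyMeasurable ψ (volume.restrict (Ioi 0)) := hv.aestronglyMeasurable.mul hf.norm
  have hψn : eLpNorm ψ p (volume.restrict (Ioi 0)) = weightedNorm p v f := by
    refine eLpNorm_congr_enorm_ae (Eventually.of_forall fun x => ?_)
    simp [ψ, enorm_smul, enorm_mul]
  rw [← hψn] at htop ⊢
  have hW : ∀ a : ℝ, AEStronglyMeasurable (fun x => x ^ a * (v x)⁻¹) (volume.restrict (Ioi 0)) :=
    fun a => (aestronglyMeasurable_rpow a _).mul hv.aestronglyMeasurable_inv
  have hU : ∀ a : ℝ, AEStronglyMeasurable (fun x => x ^ a * u x) (volume.restrict (Ioi 0)) :=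
    fun a => (aestronglyMeasurable_rpow a _).mul hu.aestronglyMeasurable
  have hUpos : ∀ a : ℝ, ∀ x > (0 : ℝ), 0 < x ^ a * u x := fun a x hx =>
    mul_pos (Real.rpow_pos_of_pos hx a) (hu.pos x hx)
  have h1 := hardy_Iio hp hpq (hW _) hψ (hU _) (hUpos _) hA' htop hA
  have h2 := hardy_Ioi hp hpq (hW _) hψ (hU _) (hUpos _) hB' htop hB
  have hprod : ∀ a : ℝ, ∀ x > (0 : ℝ), ‖x ^ a * (v x)⁻¹‖ₑ * ‖ψ x‖ₑ =
      ENNReal.ofReal (x ^ a) * ‖f x‖ₑ := fun a x hx => by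
    have hvx := hv.pos x hx
    rw [← enorm_mul, hψd, show x ^ a * (v x)⁻¹ * (v x * ‖f x‖) = x ^ a * ‖f x‖ by field_simp,
      enorm_mul, enorm_norm, Real.enorm_of_nonneg (by positivity)]
  set F₁ : ℝ → ℝ≥0∞ := fun y => ∫⁻ x in Iio (1 / y), ‖x ^ (α + 3 / 2) * (v x)⁻¹‖ₑ * ‖ψ x‖ₑ
    ∂volume.restrict (Ioi 0) with hF₁
  set F₂ : ℝ → ℝ≥0∞ := fun y => ∫⁻ x in Ioi (1 / y), ‖x ^ (α - 1 / 2) * (v x)⁻¹‖ₑ * ‖ψ x‖ₑ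
    ∂volume.restrict (Ioi 0) with hF₂
  have hF₁m : Measurable F₁ := by
    have hm : Monotone fun t : ℝ => ∫⁻ x in Iio t, ‖x ^ (α + 3 / 2) * (v x)⁻¹‖ₑ * ‖ψ x‖ₑ
      ∂volume.restrict (Ioi 0) := fun s t h => lintegral_mono_set (Iio_subset_Iio h)
    exact hm.measurable.comp (by fun_prop : Measurable fun y : ℝ => 1 / y)
  have hF₂m : Measurable F₂ := by
    have hm : Antitone fun t : ℝ => ∫⁻ x in Ioi t, ‖x ^ (α - 1 / 2) * (v x)⁻¹‖ₑ * ‖ψ x‖ₑ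
      ∂volume.restrict (Ioi 0) := fun s t h => lintegral_mono_set (Ioi_subset_Ioi h)
    exact hm.measurable.comp (by fun_prop : Measurable fun y : ℝ => 1 / y)
  have hpt : ∀ᵐ y ∂volume.restrict (Ioi (0 : ℝ)), ‖u y • struveTransform α f y‖ₑ ≤
      C.toNNReal * ‖((fun y => ‖y ^ (α + 3 / 2) * u y‖ₑ * F₁ y) +
        fun y => ‖y ^ (α - 1 / 2) * u y‖ₑ * F₂ y) y‖ₑ := by
    filter_upwards [ae_restrict_mem measurableSet_Ioi] with y hy
    have hyp : 0 < y := hy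
    have e1 : F₁ y = ∫⁻ x in Iio (1 / y), ENNReal.ofReal (x ^ (α + 3 / 2)) * ‖f x‖ₑ
        ∂volume.restrict (Ioi 0) := by
      refine lintegral_congr_ae ?_
      filter_upwards [ae_restrict_of_ae (ae_restrict_mem measurableSet_Ioi)] with x hx
      exact hprod _ x hx
    have e2 : F₂ y = ∫⁻ x in Ioi (1 / y), ENNReal.ofReal (x ^ (α - 1 / 2)) * ‖f x‖ₑ
        ∂volume.restrict (Ioi 0) := by
      refine lintegral_congr_ae ?_
      filter_upwards [ae_restrict_of_ae (ae_restrict_mem measurableSet_Ioi)] with x hx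
      exact hprod _ x hx
    have h := (enorm_struveTransform_le hfe hy).trans
      (lintegral_struveKernel_le hC hKe (fun x => ‖f x‖ₑ) hy)
    rw [← e1, ← e2] at h
    rw [enorm_smul]
    refine (mul_le_mul' le_rfl h).trans (le_of_eq ?_)
    simp only [Pi.add_apply, enorm_eq_self, enorm_mul]
    rw [Real.enorm_of_nonneg (Real.rpow_nonneg hyp.le _),
      Real.enorm_of_nonneg (Real.rpow_nonneg hyp.le _), ENNReal.ofReal]
    ring
  have hadd := eLpNorm_add_le (μ := volume.restrict (Ioi (0 : ℝ))) (p := q)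
    (f := fun y => ‖y ^ (α + 3 / 2) * u y‖ₑ * F₁ y) (g := fun y => ‖y ^ (α - 1 / 2) * u y‖ₑ * F₂ y)
    ((hU _).enorm.mul hF₁m.aemeasurable).aestronglyMeasurable
    ((hU _).enorm.mul hF₂m.aemeasurable).aestronglyMeasurable (hp.trans hpq)
  have h3 := eLpNorm_le_nnreal_smul_eLpNorm_of_ae_le_mul' hpt q
  rw [ENNReal.smul_def, smul_eq_mul] at h3
  calc _ ≤ _ := h3
    _ ≤ ENNReal.ofReal C * (4 * A * eLpNorm ψ p (volume.restrict (Ioi 0)) +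
        4 * B * eLpNorm ψ p (volume.restrict (Ioi 0))) :=
      mul_le_mul' le_rfl (hadd.trans (add_le_add h1 h2))
    _ = _ := by ring

/-! ### Test functions and duality -/

/-- The part of `S` inside a compact subset of `(0, ∞)` where `k` is bounded by `n + 1`. -/
def boundedPart (S : Set ℝ) (k : ℝ → ℝ) (n : ℕ) : Set ℝ :=
  S ∩ Icc ((n : ℝ) + 1)⁻¹ (n + 1) ∩ {x | k x ≤ n + 1}

lemma measurableSet_boundedPart {S : Set ℝ} (hS : MeasurableSet S) {k : ℝ → ℝ} (hk : Measurable k)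
    (n : ℕ) : MeasurableSet (boundedPart S k n) :=
  (hS.inter measurableSet_Icc).inter (measurableSet_le hk measurable_const)

lemma monotone_boundedPart (S : Set ℝ) (k : ℝ → ℝ) : Monotone (boundedPart S k) := by
  intro m n hmn x hx
  have h : (m : ℝ) ≤ n := by exact_mod_cast hmn
  refine ⟨⟨hx.1.1, ?_, ?_⟩, ?_⟩
  · exact le_trans (inv_anti₀ (by positivity) (by linarith)) hx.1.2.1
  · linarith [hx.1.2.2]
  · have : k x ≤ m + 1 := hx.2
    simp only [mem_ofPred_eq]; linarith

lemma iUnion_boundedPart {S : Set ℝ} (hS : S ⊆ Ioi 0) (k : ℝ → ℝ) :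
    ⋃ n, boundedPart S k n = S := by
  refine subset_antisymm (iUnion_subset fun n x hx => hx.1.1) fun x hx => ?_
  have hx0 : 0 < x := hS hx
  obtain ⟨n, hn⟩ := exists_nat_ge (max (max x x⁻¹) (k x))
  rw [max_le_iff, max_le_iff] at hn
  refine mem_iUnion.mpr ⟨n, ⟨hx, ?_, by linarith⟩, ?_⟩
  · rw [inv_le_comm₀ (by positivity) hx0]; linarith
  · simp only [mem_ofPred_eq]; linarith

lemma volume_boundedPart_ne_top (S : Set ℝ) (k : ℝ → ℝ) (n : ℕ) :
    volume (boundedPart S k n) ≠ ∞ :=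
  ne_top_of_le_ne_top (by simp) (measure_mono (inter_subset_left.trans inter_subset_right))

/-- `φ` is a nonnegative bounded measurable function supported in a compact subset of `(0, ∞)`
and in `S`. -/
structure IsTestFunction (S : Set ℝ) (φ : ℝ → ℝ) : Prop where
  measurable : Measurable φ
  nonneg : ∀ x, 0 ≤ φ x
  bounded : ∃ M, ∀ x, φ x ≤ M
  support : ∃ ε > 0, ∃ R, ∀ x, x ∉ S ∩ Icc ε R → φ x = 0

lemma isTestFunction_indicator {S : Set ℝ} {k h : ℝ → ℝ} (hh : Measurable h) (h0 : ∀ x ∈ S, 0 ≤ h x)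
    (hle : ∀ x ∈ S, h x ≤ k x) {n : ℕ} {A : Set ℝ} (hA : MeasurableSet A)
    (hAn : A ⊆ boundedPart S k n) : IsTestFunction S (A.indicator h) where
  measurable := hh.indicator hA
  nonneg x := indicator_apply_nonneg fun hx => h0 x (hAn hx).1.1
  bounded := ⟨n + 1, fun x => by
    by_cases hx : x ∈ A
    · rw [indicator_of_mem hx]
      exact (hle x (hAn hx).1.1).trans (hAn hx).2
    · rw [indicator_of_notMem hx]; positivity⟩
  support := ⟨((n : ℝ) + 1)⁻¹, by positivity, n + 1, fun x hx =>
    indicator_of_notMem (fun h => hx (hAn h).1) _⟩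

section Duality

variable {S : Set ℝ} {w : ℝ → ℝ} {a : ℝ} {κ B : ℝ≥0∞}

/-- The test functions are `1/w` on small sets `A`: they give `κ ∫_A x^a / w ≤ B |A|` for all such
`A`, hence the pointwise bound almost everywhere. -/
lemma mul_eLpNorm_top_le_of_forall_test (hS : MeasurableSet S) (hS0 : S ⊆ Ioi 0)
    (hw : Measurable w) (hw0 : ∀ x, 0 < w x)
    (H : ∀ φ, IsTestFunction S φ → κ * ∫⁻ x in S, ENNReal.ofReal (x ^ a * φ x) ≤
      B * eLpNorm (fun x => w x * φ x) 1 (volume.restrict S)) :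
    κ * eLpNorm (fun x => x ^ a * (w x)⁻¹) ∞ (volume.restrict S) ≤ B := by
  have hgm : Measurable fun x : ℝ => x ^ a * (w x)⁻¹ := by fun_prop
  have key : ∀ n, ∀ᵐ x ∂volume.restrict (boundedPart S (fun x => (w x)⁻¹) n),
      κ * ‖x ^ a * (w x)⁻¹‖ₑ ≤ B := by
    intro n
    have hm := measurableSet_boundedPart hS (k := fun x => (w x)⁻¹) (by fun_prop) n
    have hfin : IsFiniteMeasure (volume.restrict (boundedPart S (fun x => (w x)⁻¹) n)) :=
      ⟨by rw [Measure.restrict_apply_univ]; exact (volume_boundedPart_ne_top S _ n).lt_top⟩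
    refine ae_le_of_forall_setLIntegral_le_of_sigmaFinite₀ (by fun_prop) fun A hA _ => ?_
    rw [Measure.restrict_restrict hA]
    set A' := A ∩ boundedPart S (fun x => (w x)⁻¹) n
    have hA' : MeasurableSet A' := hA.inter hm
    have hA'S : A' ⊆ S := fun x hx => hx.2.1.1
    have h := H _ (isTestFunction_indicator (S := S) (k := fun x => (w x)⁻¹)
      (h := fun x => (w x)⁻¹) (by fun_prop) (fun x _ => (inv_pos.mpr (hw0 x)).le)
      (fun x _ => le_rfl) hA' inter_subset_right)
    have e1 : ∫⁻ x in S, ENNReal.ofReal (x ^ a * A'.indicator (fun x => (w x)⁻¹) x)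
        = ∫⁻ x in A', ‖x ^ a * (w x)⁻¹‖ₑ := by
      rw [← inter_eq_self_of_subset_left hA'S, ← setLIntegral_indicator hA']
      refine setLIntegral_congr_fun hS fun x hx => ?_
      rw [inter_eq_self_of_subset_left hA'S]
      have hx0 : 0 < x := hS0 hx
      by_cases hxA : x ∈ A'
      · simp only [indicator_of_mem hxA]
        rw [Real.enorm_of_nonneg (mul_nonneg (Real.rpow_nonneg hx0.le _)
          (inv_pos.mpr (hw0 x)).le)]
      · simp [indicator_of_notMem hxA]
    have e2 : eLpNorm (fun x => w x * A'.indicator (fun x => (w x)⁻¹) x) 1 (volume.restrict S)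
        = volume A' := by
      rw [eLpNorm_one_eq_lintegral_enorm]
      have : ∀ x, ‖w x * A'.indicator (fun x => (w x)⁻¹) x‖ₑ = A'.indicator 1 x := fun x => by
        by_cases hxA : x ∈ A'
        · simp [indicator_of_mem hxA, mul_inv_cancel₀ (hw0 x).ne']
        · simp [indicator_of_notMem hxA]
      simp_rw [this]
      rw [lintegral_indicator_one hA', Measure.restrict_apply hA', inter_eq_self_of_subset_left hA'S]
    rw [e1, e2] at h
    rw [lintegral_const_mul _ (by fun_prop), setLIntegral_const]
    exact h
  have hall : ∀ᵐ x ∂volume.restrict S, κ * ‖x ^ a * (w x)⁻¹‖ₑ ≤ B := by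
    rw [← iUnion_boundedPart hS0 (fun x => (w x)⁻¹), ae_restrict_iUnion_iff]
    exact key
  rw [eLpNorm_exponent_top, eLpNormEssSup, ← ENNReal.essSup_const_mul]
  exact essSup_le_of_ae_le _ hall

/-- The extremizer of Hölder's inequality is `h = g^(p' - 1) / w` with `g = x^a / w`: then `x^a h =
g^p'`, while `w h = g^(p' - 1)` has `p`-norm `(∫ g^p')^(1/p)` for `p < ∞`. Truncation makes `h`
admissible and the integrals finite, so the common factor cancels; monotone convergence removes the
truncation. -/
lemma mul_eLpNorm_le_of_forall_test_of_ne_top {p p' : ℝ≥0∞} [ENNReal.HolderConjugate p' p]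
    (hp' : p' ≠ ∞) (hS : MeasurableSet S) (hS0 : S ⊆ Ioi 0)
    (hw : Measurable w) (hw0 : ∀ x, 0 < w x)
    (H : ∀ φ, IsTestFunction S φ → κ * ∫⁻ x in S, ENNReal.ofReal (x ^ a * φ x) ≤
      B * eLpNorm (fun x => w x * φ x) p (volume.restrict S)) :
    κ * eLpNorm (fun x => x ^ a * (w x)⁻¹) p' (volume.restrict S) ≤ B := by
  have h1p' : 1 ≤ p' := ENNReal.HolderTriple.le p' p 1
  have hp'0 : p' ≠ 0 := (zero_lt_one.trans_le h1p').ne'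
  set ρ := p'.toReal with hρ
  have hρ1 : 1 ≤ ρ := by rw [hρ, ← ENNReal.toReal_one]; exact ENNReal.toReal_mono hp' h1p'
  have hρ0 : 0 < ρ := by linarith
  set g : ℝ → ℝ := fun x => x ^ a * (w x)⁻¹ with hg
  have hgm : Measurable g := by fun_prop
  have hgpos : ∀ x ∈ S, 0 < g x := fun x hx =>
    mul_pos (Real.rpow_pos_of_pos (hS0 hx) a) (inv_pos.mpr (hw0 x))
  set h : ℝ → ℝ := fun x => g x ^ (ρ - 1) * (w x)⁻¹ with hh
  have hhm : Measurable h := by fun_prop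
  have hh0 : ∀ x ∈ S, 0 ≤ h x := fun x hx =>
    mul_nonneg (Real.rpow_nonneg (hgpos x hx).le _) (inv_pos.mpr (hw0 x)).le
  -- A bound on the sum bounds both the test function `h` and `g`, the latter for the finiteness of
  -- `I n`.
  set k : ℝ → ℝ := fun x => h x + g x with hk
  have hkm : Measurable k := hhm.add hgm
  set I : ℕ → ℝ≥0∞ := fun n => ∫⁻ x in boundedPart S k n, ‖g x‖ₑ ^ ρ with hI
  have hIsup : ∫⁻ x in S, ‖g x‖ₑ ^ ρ = ⨆ n, I n := by
    conv_lhs => rw [← iUnion_boundedPart hS0 k]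
    exact setLIntegral_iUnion_of_directed _ (monotone_boundedPart S k).directed_le
  have hIfin : ∀ n, I n ≠ ∞ := fun n => by
    refine ne_top_of_le_ne_top ?_ (setLIntegral_mono' (g := fun _ => ENNReal.ofReal (n + 1) ^ ρ)
      (measurableSet_boundedPart hS hkm n) fun x hx => ?_)
    · rw [setLIntegral_const]
      exact ENNReal.mul_ne_top (ENNReal.rpow_ne_top_of_nonneg hρ0.le ENNReal.ofReal_ne_top)
        (volume_boundedPart_ne_top S k n)
    · have h1 : k x ≤ n + 1 := hx.2
      rw [Real.enorm_of_nonneg (hgpos x hx.1.1).le]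
      refine ENNReal.rpow_le_rpow (ENNReal.ofReal_le_ofReal ?_) hρ0.le
      linarith [hh0 x hx.1.1]
  have hwφ : ∀ n, ∀ x ∈ S, ‖w x * (boundedPart S k n).indicator h x‖ₑ
      = (boundedPart S k n).indicator (fun x => ‖g x‖ₑ ^ (ρ - 1)) x := fun n x hx => by
    by_cases hxA : x ∈ boundedPart S k n
    · simp only [indicator_of_mem hxA]
      have hwx := hw0 x
      rw [hh, show w x * (g x ^ (ρ - 1) * (w x)⁻¹) = g x ^ (ρ - 1) by field_simp,
        Real.enorm_of_nonneg (Real.rpow_nonneg (hgpos x hx).le _),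
        Real.enorm_of_nonneg (hgpos x hx).le,
        ENNReal.ofReal_rpow_of_pos (hgpos x hx)]
    · simp [indicator_of_notMem hxA]
  have hnorm : ∀ n, eLpNorm (fun x => w x * (boundedPart S k n).indicator h x) p
      (volume.restrict S) ≤ I n ^ (1 - 1 / ρ) := by
    intro n
    have hinv : p'⁻¹ + p⁻¹ = 1 := ENNReal.HolderConjugate.inv_add_inv_eq_one p' p
    rcases eq_or_ne p ∞ with hp | hp
    · have hone : ρ = 1 := by
        rw [hp, ENNReal.inv_top, add_zero, ENNReal.inv_eq_one] at hinv
        rw [hρ, hinv, ENNReal.toReal_one]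
      rw [hone, hp, div_one, sub_self, ENNReal.rpow_zero, eLpNorm_exponent_top]
      refine eLpNormEssSup_le_of_ae_enorm_bound ?_
      filter_upwards [ae_restrict_mem hS] with x hx
      rw [hwφ n x hx, hone, sub_self]
      by_cases hxA : x ∈ boundedPart S k n
      · simp [indicator_of_mem hxA]
      · simp [indicator_of_notMem hxA]
    · have h1p : 1 ≤ p := ENNReal.HolderTriple.le p p' 1
      have hp0 : p ≠ 0 := (zero_lt_one.trans_le h1p).ne'
      have hP : 0 < p.toReal := ENNReal.toReal_pos hp0 hp
      have hreal : ρ⁻¹ + p.toReal⁻¹ = 1 := by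
        have := congrArg ENNReal.toReal hinv
        rwa [ENNReal.toReal_add (ENNReal.inv_ne_top.mpr hp'0) (ENNReal.inv_ne_top.mpr hp0),
          ENNReal.toReal_inv, ENNReal.toReal_inv, ENNReal.toReal_one] at this
      have hmul : (ρ - 1) * p.toReal = ρ := by
        field_simp at hreal; linarith
      rw [eLpNorm_eq_lintegral_rpow_enorm_toReal hp0 hp]
      refine le_of_eq ?_
      have e : 1 - 1 / ρ = 1 / p.toReal := by rw [one_div, one_div]; linarith
      rw [e]
      congr 1
      rw [hI]
      have hsub : boundedPart S k n ⊆ S := fun x hx => hx.1.1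
      simp only
      conv_rhs => rw [← inter_eq_self_of_subset_left hsub]
      rw [← setLIntegral_indicator (measurableSet_boundedPart hS hkm n)]
      refine setLIntegral_congr_fun hS fun x hx => ?_
      simp only [hwφ n x hx]
      by_cases hxA : x ∈ boundedPart S k n
      · simp only [indicator_of_mem hxA]
        rw [← ENNReal.rpow_mul, hmul]
      · simp only [indicator_of_notMem hxA]
        exact ENNReal.zero_rpow_of_pos hP
  have hmain : ∀ n, κ * I n ^ (1 / ρ) ≤ B := by
    intro n
    have hT := H _ (isTestFunction_indicator (S := S) (k := k) (h := h) (n := n) hhm hh0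
      (fun x hx => by linarith [hgpos x hx]) (measurableSet_boundedPart hS hkm n) subset_rfl)
    have e1 : ∫⁻ x in S, ENNReal.ofReal (x ^ a * (boundedPart S k n).indicator h x) = I n := by
      have hsub : boundedPart S k n ⊆ S := fun x hx => hx.1.1
      rw [hI]
      simp only
      conv_rhs => rw [← inter_eq_self_of_subset_left hsub]
      rw [← setLIntegral_indicator (measurableSet_boundedPart hS hkm n)]
      refine setLIntegral_congr_fun hS fun x hx => ?_
      by_cases hxA : x ∈ boundedPart S k n
      · simp only [indicator_of_mem hxA]
        have hgx := hgpos x hx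
        rw [Real.enorm_of_nonneg hgx.le, ENNReal.ofReal_rpow_of_pos hgx]
        congr 1
        rw [hh, show x ^ a * (g x ^ (ρ - 1) * (w x)⁻¹) = g x ^ (ρ - 1) * g x by
          rw [hg]; ring, ← Real.rpow_add_one hgx.ne']
        congr 1; ring
      · simp [indicator_of_notMem hxA]
    rw [e1] at hT
    have hT2 := hT.trans (mul_le_mul' le_rfl (hnorm n))
    rcases eq_or_ne (I n) 0 with h0 | h0
    · rw [h0, ENNReal.zero_rpow_of_pos (by positivity), mul_zero]; exact zero_le
    · have hsplit : I n = I n ^ (1 / ρ) * I n ^ (1 - 1 / ρ) := by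
        rw [← ENNReal.rpow_add _ _ h0 (hIfin n), add_sub_cancel, ENNReal.rpow_one]
      conv_lhs at hT2 => rw [hsplit, ← mul_assoc]
      have hexp : 0 ≤ 1 - 1 / ρ := by rw [sub_nonneg, div_le_one hρ0]; exact hρ1
      exact (ENNReal.mul_le_mul_iff_left
        (ENNReal.rpow_pos (pos_iff_ne_zero.mpr h0) (hIfin n)).ne'
        (ENNReal.rpow_ne_top_of_nonneg hexp (hIfin n))).mp hT2
  rw [eLpNorm_eq_lintegral_rpow_enorm_toReal hp'0 hp', ← hρ, hIsup]
  have hsup : (⨆ n, I n) ^ (1 / ρ) = ⨆ n, I n ^ (1 / ρ) :=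
    (ENNReal.orderIsoRpow (1 / ρ) (by positivity)).map_iSup I
  rw [hsup, ENNReal.mul_iSup]
  exact iSup_le hmain

/-- The `L^p'` norm is determined by testing against bounded functions of compact support. -/
lemma mul_eLpNorm_le_of_forall_test {p p' : ℝ≥0∞} [ENNReal.HolderConjugate p' p]
    (hS : MeasurableSet S) (hS0 : S ⊆ Ioi 0) (hw : Measurable w) (hw0 : ∀ x, 0 < w x)
    (H : ∀ φ, IsTestFunction S φ → κ * ∫⁻ x in S, ENNReal.ofReal (x ^ a * φ x) ≤
      B * eLpNorm (fun x => w x * φ x) p (volume.restrict S)) :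
    κ * eLpNorm (fun x => x ^ a * (w x)⁻¹) p' (volume.restrict S) ≤ B := by
  rcases eq_or_ne p' ∞ with hp' | hp'
  · have hp : p = 1 := by
      have hinv : p'⁻¹ + p⁻¹ = 1 := ENNReal.HolderConjugate.inv_add_inv_eq_one p' p
      rwa [hp', ENNReal.inv_top, zero_add, ENNReal.inv_eq_one] at hinv
    subst hp hp'
    exact mul_eLpNorm_top_le_of_forall_test hS hS0 hw hw0 H
  · exact mul_eLpNorm_le_of_forall_test_of_ne_top hp' hS hS0 hw hw0 H

end Duality

/-! ### Necessity of the two conditions -/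

lemma integrable_struveKernel_smul {𝕜 : Type*} [RCLike 𝕜] {α : ℝ} (hα : 1 / 2 < α) {S : Set ℝ}
    {φ : ℝ → ℝ} (hφ : IsTestFunction S φ) {y : ℝ} (hy : 0 < y) :
    Integrable (fun x => struveKernel α x y • (φ x : 𝕜)) (volume.restrict (Ioi 0)) := by
  obtain ⟨c, hc, C, hC, hK⟩ := exists_struveKernel_bounds hα
  obtain ⟨M, hM⟩ := hφ.bounded
  obtain ⟨ε, hε, R, hR⟩ := hφ.support
  have hM0 : 0 ≤ M := (hφ.nonneg 0).trans (hM 0)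
  have hmaj : Integrable ((Icc ε R).indicator fun _ => C * (R * y) ^ (α - 1 / 2) * M)
      (volume.restrict (Ioi (0 : ℝ))) := by
    refine (IntegrableOn.integrable_indicator ?_ measurableSet_Icc).restrict
    exact integrableOn_const (by simp)
  refine hmaj.mono' ((aestronglyMeasurable_struveKernel hα hy).smul
    (RCLike.measurable_ofReal.comp hφ.measurable).aestronglyMeasurable) ?_
  filter_upwards [ae_restrict_mem measurableSet_Ioi] with x hx
  have hx0 : 0 < x := hx
  by_cases hxI : x ∈ Icc ε R
  · rw [indicator_of_mem hxI, norm_smul, RCLike.norm_ofReal, abs_of_nonneg (hφ.nonneg x)]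
    refine mul_le_mul ?_ (hM x) (hφ.nonneg x) ?_
    · rw [Real.norm_of_nonneg (le_trans (by positivity) (hK x hx y hy).1)]
      refine (hK x hx y hy).2.trans (mul_le_mul_of_nonneg_left ?_ hC.le)
      calc (x * y) ^ (α - 1 / 2) * min 1 ((x * y) ^ 2) ≤ (R * y) ^ (α - 1 / 2) * 1 := by
            refine mul_le_mul ?_ (min_le_left _ _) (by positivity) ?_
            · exact Real.rpow_le_rpow (by positivity)
                (mul_le_mul_of_nonneg_right hxI.2 hy.le) (by linarith)
            · exact Real.rpow_nonneg (mul_nonneg (hx0.le.trans hxI.2) hy.le) _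
        _ = _ := mul_one _
    · exact mul_nonneg hC.le (Real.rpow_nonneg (mul_nonneg (hx0.le.trans hxI.2) hy.le) _)
  · rw [indicator_of_notMem hxI, hR x fun h => hxI h.2]; simp

lemma tendsto_integral_Ioc_of_isTestFunction {𝕜 : Type*} [RCLike 𝕜] {α : ℝ} {S : Set ℝ}
    {φ : ℝ → ℝ} (hφ : IsTestFunction S φ) (y : ℝ) :
    Tendsto (fun N : ℝ => ∫ x in Ioc 0 N, struveKernel α x y • (φ x : 𝕜)) atTop
      (𝓝 (∫ x in Ioi 0, struveKernel α x y • (φ x : 𝕜))) := by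
  obtain ⟨ε, hε, R, hR⟩ := hφ.support
  refine tendsto_const_nhds.congr' ?_
  filter_upwards [eventually_ge_atTop R] with N hN
  refine setIntegral_eq_of_subset_of_forall_sdiff_eq_zero measurableSet_Ioi Ioc_subset_Ioi_self ?_
  intro x hx
  have : φ x = 0 := hR x fun h => hx.2 ⟨hx.1, h.2.2.trans hN⟩
  simp [this]

lemma struveTransformExists_of_isTestFunction {𝕜 : Type*} [RCLike 𝕜] {α : ℝ} (hα : 1 / 2 < α)
    {S : Set ℝ} {φ : ℝ → ℝ} (hφ : IsTestFunction S φ) :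
    StruveTransformExists α fun x => (φ x : 𝕜) := fun y hy =>
  ⟨fun _ _ => IntegrableOn.mono_set (integrable_struveKernel_smul hα hφ hy) Ioc_subset_Ioi_self,
    _, tendsto_integral_Ioc_of_isTestFunction hφ y⟩

lemma enorm_struveTransform_of_isTestFunction {𝕜 : Type*} [RCLike 𝕜] {α : ℝ} (hα : 1 / 2 < α)
    {S : Set ℝ} {φ : ℝ → ℝ} (hφ : IsTestFunction S φ) {y : ℝ} (hy : 0 < y) :
    ‖struveTransform α (fun x => (φ x : 𝕜)) y‖ₑ =
      ∫⁻ x in Ioi 0, ENNReal.ofReal (struveKernel α x y * φ x) := by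
  obtain ⟨c, hc, C, hC, hK⟩ := exists_struveKernel_bounds hα
  have h0 : 0 ≤ᵐ[volume.restrict (Ioi 0)] fun x => struveKernel α x y * φ x := by
    filter_upwards [ae_restrict_mem measurableSet_Ioi] with x hx
    have hx0 : 0 < x := hx
    exact mul_nonneg (le_trans (by positivity) (hK x hx y hy).1) (hφ.nonneg x)
  have hint : Integrable (fun x => struveKernel α x y * φ x) (volume.restrict (Ioi 0)) := by
    simpa using integrable_struveKernel_smul (𝕜 := ℝ) hα hφ hy
  have e : struveTransform α (fun x => (φ x : 𝕜)) y =
      ((∫ x in Ioi 0, struveKernel α x y * φ x : ℝ) : 𝕜) := by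
    rw [struveTransform, (tendsto_integral_Ioc_of_isTestFunction hφ y).limUnder_eq,
      ← integral_ofReal]
    simp [RCLike.real_smul_eq_coe_mul]
  rw [e, ← ofReal_integral_eq_lintegral_ofReal hint h0, ← Real.enorm_of_nonneg
    (integral_nonneg_of_ae h0), ← ofReal_norm, RCLike.norm_ofReal, ← Real.norm_eq_abs,
    ofReal_norm]

lemma mul_eLpNorm_le_of_enorm_le {E : Type*} [NormedAddCommGroup E] {μ : Measure ℝ} {q Q : ℝ≥0∞}
    (hQ : Q ≠ ∞) {G : ℝ → ℝ} {f : ℝ → E} (h : ∀ᵐ y ∂μ, Q * ‖G y‖ₑ ≤ ‖f y‖ₑ) :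
    Q * eLpNorm G q μ ≤ eLpNorm f q μ := by
  rcases eq_or_ne Q 0 with h0 | h0
  · simp [h0]
  have h2 : ∀ᵐ y ∂μ, ‖G y‖ₑ ≤ (Q⁻¹).toNNReal * ‖f y‖ₑ := by
    filter_upwards [h] with y hy
    rw [ENNReal.coe_toNNReal (ENNReal.inv_ne_top.mpr h0)]
    refine le_trans (le_of_eq ?_) (mul_le_mul' le_rfl hy)
    rw [← mul_assoc, ENNReal.inv_mul_cancel h0 hQ, one_mul]
  have h3 := eLpNorm_le_nnreal_smul_eLpNorm_of_ae_le_mul' h2 q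
  rw [ENNReal.smul_def, smul_eq_mul, ENNReal.coe_toNNReal (ENNReal.inv_ne_top.mpr h0)] at h3
  refine (mul_le_mul' le_rfl h3).trans (le_of_eq ?_)
  rw [← mul_assoc, ENNReal.mul_inv_cancel h0 hQ, one_mul]

/-- A lower bound `c (x y)^a` of the kernel on `S × T` turns the norm inequality into a bound for
the product of the norms of the weights on `T` and `S`. -/
theorem mul_eLpNorm_le_of_weightedNorm_le {𝕜 : Type*} [RCLike 𝕜] {α : ℝ} (hα : 1 / 2 < α)
    {p q p' : ℝ≥0∞} [ENNReal.HolderConjugate p' p]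
    {u v : ℝ → ℝ} (hv : IsWeight v) {C : ℝ≥0}
    (hC : ∀ f : ℝ → 𝕜,
        AEStronglyMeasurable f (volume.restrict (Ioi 0)) → StruveTransformExists α f →
          weightedNorm q u (struveTransform α f) ≤ C * weightedNorm p v f)
    {S T : Set ℝ} (hS : MeasurableSet S) (hT : MeasurableSet T) (hS0 : S ⊆ Ioi 0) (hT0 : T ⊆ Ioi 0)
    (hTne : T.Nonempty) {a c : ℝ} (hc : 0 < c)
    (hK : ∀ x ∈ S, ∀ y ∈ T, c * (x ^ a * y ^ a) ≤ struveKernel α x y) :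
    eLpNorm (fun x => x ^ a * u x) q (volume.restrict T) *
      eLpNorm (fun x => x ^ a * (v x)⁻¹) p' (volume.restrict S) ≤ C / ENNReal.ofReal c := by
  -- The duality lemma needs a Borel weight that is positive everywhere, so `v` is replaced by such
  -- a representative.
  obtain ⟨w, hwm, hw0, hwv⟩ : ∃ w : ℝ → ℝ, Measurable w ∧ (∀ x, 0 < w x) ∧
      v =ᵐ[volume.restrict (Ioi 0)] w := by
    have hv' := hv.aestronglyMeasurable
    have hm := hv'.stronglyMeasurable_mk.measurable
    refine ⟨fun x => if 0 < hv'.mk v x then hv'.mk v x else 1,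
      Measurable.ite (measurableSet_lt measurable_const hm) hm measurable_const, fun x => ?_, ?_⟩
    · dsimp only
      split_ifs with h
      · exact h
      · exact one_pos
    · filter_upwards [hv'.ae_eq_mk, ae_restrict_mem measurableSet_Ioi] with x hx hx0
      rw [← hx, if_pos (hv.pos x hx0)]
  have hwS : v =ᵐ[volume.restrict S] w := ae_restrict_of_ae_restrict_of_subset hS0 hwv
  have hnorm : eLpNorm (fun x => x ^ a * (v x)⁻¹) p' (volume.restrict S)
      = eLpNorm (fun x => x ^ a * (w x)⁻¹) p' (volume.restrict S) := by
    refine eLpNorm_congr_ae ?_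
    filter_upwards [hwS] with x hx
    rw [hx]
  rw [hnorm]
  refine mul_eLpNorm_le_of_forall_test (p := p) hS hS0 hwm hw0 fun φ hφ => ?_
  have hfm : AEStronglyMeasurable (fun x => (φ x : 𝕜)) (volume.restrict (Ioi 0)) :=
    (RCLike.measurable_ofReal.comp hφ.measurable).aestronglyMeasurable
  have hmain := hC _ hfm (struveTransformExists_of_isTestFunction hα hφ)
  set Q : ℝ≥0∞ := ∫⁻ x in S, ENNReal.ofReal (x ^ a * φ x) with hQ
  have hpt : ∀ y ∈ T, ENNReal.ofReal c * Q * ENNReal.ofReal (y ^ a) ≤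
      ‖struveTransform α (fun x => (φ x : 𝕜)) y‖ₑ := by
    intro y hy
    have hy0 : 0 < y := hT0 hy
    rw [enorm_struveTransform_of_isTestFunction hα hφ hy0, mul_right_comm,
      ← ENNReal.ofReal_mul hc.le, hQ, ← lintegral_const_mul' _ _ ENNReal.ofReal_ne_top]
    refine le_trans ?_ (lintegral_mono_set hS0)
    refine setLIntegral_mono' hS fun x hx => ?_
    rw [← ENNReal.ofReal_mul (by positivity)]
    refine ENNReal.ofReal_le_ofReal ?_
    calc c * y ^ a * (x ^ a * φ x) = c * (x ^ a * y ^ a) * φ x := by ring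
      _ ≤ _ := mul_le_mul_of_nonneg_right (hK x hx y hy) (hφ.nonneg x)
  -- The transform has a finite value at any point of `T`, and that value dominates a positive
  -- multiple of `Q`.
  have hQtop : ENNReal.ofReal c * Q ≠ ∞ := by
    obtain ⟨y, hy⟩ := hTne
    intro h
    have hy0 : 0 < y := hT0 hy
    have := hpt y hy
    rw [h, ENNReal.top_mul (ENNReal.ofReal_pos.mpr (Real.rpow_pos_of_pos hy0 a)).ne'] at this
    exact enorm_ne_top (top_le_iff.mp this)
  have hlow : ENNReal.ofReal c * Q * eLpNorm (fun x => x ^ a * u x) q (volume.restrict T) ≤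
      weightedNorm q u (struveTransform α fun x => (φ x : 𝕜)) := by
    refine (mul_eLpNorm_le_of_enorm_le hQtop
      (f := fun y => u y • struveTransform α (fun x => (φ x : 𝕜)) y) ?_).trans
      (eLpNorm_mono_measure _ (Measure.restrict_mono hT0 le_rfl))
    filter_upwards [ae_restrict_mem hT] with y hy
    have hy0 : 0 < y := hT0 hy
    rw [enorm_mul, enorm_smul, Real.enorm_of_nonneg (Real.rpow_nonneg hy0.le a), ← mul_assoc,
      mul_comm ‖u y‖ₑ]
    exact mul_le_mul' (hpt y hy) le_rfl
  have hup : weightedNorm p v (fun x => (φ x : 𝕜)) =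
      eLpNorm (fun x => w x * φ x) p (volume.restrict S) := by
    have e : S.indicator (fun x => w x * φ x) = fun x => w x * φ x := by
      refine indicator_eq_self.mpr fun x hx => ?_
      by_contra hxS
      obtain ⟨ε, hε, R, hR⟩ := hφ.support
      exact hx (by simp [hR x fun h => hxS h.1])
    have h1 : eLpNorm (fun x => w x * φ x) p (volume.restrict S) =
        eLpNorm (fun x => w x * φ x) p (volume.restrict (Ioi 0)) := by
      conv_rhs => rw [← e]
      rw [eLpNorm_indicator_eq_eLpNorm_restrict hS, Measure.restrict_restrict hS,
        inter_eq_self_of_subset_left hS0]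
    rw [h1, weightedNorm]
    refine eLpNorm_congr_enorm_ae ?_
    filter_upwards [hwv] with x hx
    rw [hx, enorm_smul, enorm_mul, ← ofReal_norm (φ x : 𝕜), RCLike.norm_ofReal,
      ← Real.norm_eq_abs, ofReal_norm]
  have hfin := hlow.trans hmain
  rw [hup] at hfin
  have hc0 : ENNReal.ofReal c ≠ 0 := (ENNReal.ofReal_pos.mpr hc).ne'
  rw [mul_comm (_ / _), ← mul_div_assoc, ENNReal.le_div_iff_mul_le (Or.inl hc0)
    (Or.inl ENNReal.ofReal_ne_top), mul_comm _ (C : ℝ≥0∞)]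
  refine le_trans (le_of_eq ?_) hfin
  ring

/-! ### The equivalence -/

theorem theorem5p1 {𝕜 : Type*} [RCLike 𝕜] (α : ℝ) (hα : 1 / 2 < α)
    (p q p' : ℝ≥0∞) (hp : 1 ≤ p) (hpq : p ≤ q) (hp' : 1 / p + 1 / p' = 1)
    (u v : ℝ → ℝ) (hu : IsWeight u) (hv : IsWeight v) :
    (∃ C : ℝ≥0, 0 < C ∧ ∀ f : ℝ → 𝕜,
        AEStronglyMeasurable f (volume.restrict (Ioi 0)) → StruveTransformExists α f →
          weightedNorm q u (struveTransform α f) ≤ C * weightedNorm p v f) ↔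
      ((⨆ (t : ℝ) (_ : 0 < t),
          eLpNorm (fun x => x ^ (α + 3 / 2) * u x) q (volume.restrict (Ioo 0 (1 / t))) *
            eLpNorm (fun x => x ^ (α + 3 / 2) * (v x)⁻¹) p' (volume.restrict (Ioo 0 t))) < ∞ ∧
        (⨆ (t : ℝ) (_ : 0 < t),
          eLpNorm (fun x => x ^ (α - 1 / 2) * u x) q (volume.restrict (Ioi (1 / t))) *
            eLpNorm (fun x => x ^ (α - 1 / 2) * (v x)⁻¹) p' (volume.restrict (Ioi t))) < ∞) := by
  have hconj : ENNReal.HolderConjugate p' p := by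
    rw [ENNReal.holderConjugate_iff, add_comm]
    simpa using hp'
  constructor
  · rintro ⟨C, -, hC⟩
    obtain ⟨c, hc, C₀, -, hK⟩ := exists_struveKernel_bounds hα
    have hfin : (C : ℝ≥0∞) / ENNReal.ofReal c < ∞ :=
      ENNReal.div_lt_top ENNReal.coe_ne_top (ENNReal.ofReal_pos.mpr hc).ne'
    constructor
    · refine lt_of_le_of_lt (iSup₂_le fun t ht => ?_) hfin
      refine mul_eLpNorm_le_of_weightedNorm_le hα (p := p) hv hC measurableSet_Ioo
        measurableSet_Ioo Ioo_subset_Ioi_self Ioo_subset_Ioi_self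
        (nonempty_Ioo.mpr (one_div_pos.mpr ht)) hc fun x hx y hy => ?_
      refine le_trans (le_of_eq ?_) (hK x hx.1 y hy.1).1
      have hx0 := hx.1
      have hy0 := hy.1
      have hxy : 0 < x * y := mul_pos hx0 hy0
      have h1 : x * y ≤ 1 := by
        calc x * y ≤ t * (1 / t) := mul_le_mul hx.2.le hy.2.le hy0.le ht.le
          _ = 1 := mul_one_div_cancel ht.ne'
      rw [min_eq_right (by nlinarith), ← Real.mul_rpow hx0.le hy0.le, ← Real.rpow_natCast,
        ← Real.rpow_add hxy]
      congr 2; push_cast; ring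
    · refine lt_of_le_of_lt (iSup₂_le fun t ht => ?_) hfin
      have ht' : 0 < 1 / t := one_div_pos.mpr ht
      refine mul_eLpNorm_le_of_weightedNorm_le hα (p := p) hv hC measurableSet_Ioi
        measurableSet_Ioi (Ioi_subset_Ioi ht.le) (Ioi_subset_Ioi ht'.le)
        nonempty_Ioi hc fun x hx y hy => ?_
      have hx0 : 0 < x := ht.trans hx
      have hy0 : 0 < y := ht'.trans hy
      refine le_trans (le_of_eq ?_) (hK x hx0 y hy0).1
      have h1 : 1 ≤ x * y := by
        calc 1 = t * (1 / t) := (mul_one_div_cancel ht.ne').symm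
          _ ≤ x * y := mul_le_mul (le_of_lt hx) (le_of_lt hy) ht'.le hx0.le
      rw [min_eq_left (by nlinarith), ← Real.mul_rpow hx0.le hy0.le, mul_one]
  · rintro ⟨hA, hB⟩
    exact weightedNorm_struveTransform_le hα hp hpq hu hv hA.ne hB.ne
      (fun t ht => le_iSup₂_of_le t ht le_rfl) fun t ht => le_iSup₂_of_le t ht le_rfl
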